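/- **Definitions.** Let $A_n=\{1,\dots,n\}$ with its usual order. A *timed word* of length $l(w)=r\ge 0$ is a right-continuous piecewise constant function $w:[0,r)\to A_n$ with finitely many discontinuities; timed words form a monoid $A_n^\dagger$ under concatenation, with unit the empty word $\emptyset$. Write $c^t$ for the constant word $c$ of length $t\ge0$; every timed word is a product $c_1^{t_1}\cdots c_k^{t_k}$. For $0\le a\le b\le l(w)$ let $w_{[a,b)}$ be the word $t\mapsto w(a+t)$ of length $b-a$. A *timed row* is a weakly increasing timed word; it has the form $1^{m_1}\cdots n^{m_n}$ with $m_i\ge0$ the measure of the set where it takes the value $i$. Every timed word has a unique *row decomposition* $w=u_lu_{l-1}\cdots u_1$ into non-empty timed rows such that no $u_iu_{i-1}$ is a row (with $l=0$ for $w=\emptyset$). For timed rows write $u\lhd v$ if $l(u)\ge l(v)$ and $u(t)<v(t)$ for $0\le t<l(v)$. The word $w$ is a *timed tableau* if $u_1\lhd\cdots\lhd u_l$; its *shape* is then $(l(u_1),\dots,l(u_l))$. A shape is a real partition, and real partitions that differ only by trailing zeroes are regarded as equal. *Insertion.* For a timed row $u$, a letter $c$ and $t\ge0$: if $u\le c$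 everywhere, then $\mathrm{RINS}(u,c^t)=(\emptyset,uc^t)$; otherwise, with $t_0=\min\{x: u(x)>c\}$, $$\mathrm{RINS}(u,c^t)=\begin{cases}(u_{[t_0,t_0+t)},\,u_{[0,t_0)}c^tu_{[t_0+t,l(u))})&\text{if } l(u)-t_0>t,\\(u_{[t_0,l(u))},\,u_{[0,t_0)}c^t)&\text{if } l(u)-t_0\le t.\end{cases}$$ For a timed row $v=c_1^{t_1}\cdots c_k^{t_k}$, let $\mathrm{RINS}(u,v)=(v_1\cdots v_k,u_k)$, where $u_0=u$ and $(v_i,u_i)=\mathrm{RINS}(u_{i-1},c_i^{t_i})$. For a timed tableau $w$ with row decomposition $u_l\cdots u_1$ and a timed row $v$, let $\mathrm{INSERT}(w,v)=v_l'u_l'\cdots u_1'$, where $v_0'=v$ and $(v_i',u_i')=\mathrm{RINS}(u_i,v_{i-1}')$. If $w$ has row decomposition $u_1u_2\cdots u_l$ (factors numbered from left to right), its *insertion tableau* is $P(w)=\mathrm{INSERT}(\cdots\mathrm{INSERT}(\mathrm{INSERT}(u_1,u_2),u_3)\cdots,u_l)$, and $P(\emptyset)=\emptyset$. *Greene invariants.*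 For a finite disjoint union $S\subseteq[0,l(w))$ of intervals $[a,b)$, the timed subword $w_S$ is the timed word of length $\mathrm{meas}(S)$ with $$w_S(t)=w\bigl(\inf\{x\in[0,l(w)):\mathrm{meas}([0,x)\cap S)>t\}\bigr)\qquad(0\le t<\mathrm{meas}(S)).$$ For $k\ge1$, $a_k(w)$ is the supremum of $l(w_{S_1})+\cdots+l(w_{S_k})$ over all families of pairwise disjoint sets $S_1,\dots,S_k$ of this kind for which every $w_{S_i}$ is a timed row. **Theorem (timed version of Greene's theorem).** For every timed word $w\in A_n^\dagger$, $P(w)$ is a timed tableau, and if $P(w)$ has shape $\lambda=(\lambda_1,\dots,\lambda_l)$, then $$a_k(w)=\lambda_1+\cdots+\lambda_k\qquad\text{for }k=1,\dots,l .$$ -/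

import Mathlib

open Set MeasureTheory
open scoped NNReal

/-- A timed word of length `len` in the alphabet `A_n = Fin n`: a right-continuous,
piecewise constant function `[0, len) → A_n` with finitely many breaks.
The function is extended to `ℝ` by the extra value `⊥` (no letter) outside `[0, len)`.
`D` is a finite set containing the break points: the function is constant on
`[x, y] ⊆ [0, len)` as soon as no break point lies in `(x, y]`. -/
structure TimedWord (n : ℕ) where
  len : ℝ
  toFun : ℝ → WithBot (Fin n)
  len_nonneg : 0 ≤ len
  toFun_ne_bot_iff : ∀ x, toFun x ≠ ⊥ ↔ 0 ≤ x ∧ x < len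
  finite_breaks : ∃ D : Finset ℝ, ∀ x y, 0 ≤ x → x ≤ y → y < len →
    (∀ d ∈ D, ¬ (x < d ∧ d ≤ y)) → toFun x = toFun y

namespace TimedWord

variable {n : ℕ}

theorem toFun_eq_bot (w : TimedWord n) {x : ℝ} (h : ¬ (0 ≤ x ∧ x < w.len)) : w.toFun x = ⊥ := by
  by_contra h'
  exact h ((w.toFun_ne_bot_iff x).1 h')

theorem len_eq_of_toFun_eq {u v : TimedWord n} (h : u.toFun = v.toFun) : u.len = v.len := by
  have key : ∀ x, (0 ≤ x ∧ x < u.len) ↔ (0 ≤ x ∧ x < v.len) := fun x => by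
    rw [← u.toFun_ne_bot_iff, ← v.toFun_ne_bot_iff, h]
  have hu := u.len_nonneg
  have hv := v.len_nonneg
  rcases lt_trichotomy u.len v.len with h1 | h1 | h1
  · exact absurd ((key u.len).2 ⟨hu, h1⟩).2 (lt_irrefl _)
  · exact h1
  · exact absurd ((key v.len).1 ⟨hv, h1⟩).2 (lt_irrefl _)

theorem ext_toFun {u v : TimedWord n} (h : u.toFun = v.toFun) : u = v := by
  have hl := len_eq_of_toFun_eq h
  cases u
  cases v
  cases h
  cases hl
  rfl

/-- The empty word. -/
instance : One (TimedWord n) where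
  one :=
    { len := 0
      toFun := fun _ => ⊥
      len_nonneg := le_rfl
      toFun_ne_bot_iff := fun x => by
        constructor
        · intro h; exact absurd rfl h
        · rintro ⟨h1, h2⟩; exact absurd (lt_of_le_of_lt h1 h2) (lt_irrefl _)
      finite_breaks := ⟨∅, fun _ _ _ _ _ _ => rfl⟩ }

open Classical in
/-- Concatenation of timed words. -/
noncomputable instance : Mul (TimedWord n) where
  mul u v :=
    { len := u.len + v.len
      toFun := fun x => if x < u.len then u.toFun x else v.toFun (x - u.len)
      len_nonneg := add_nonneg u.len_nonneg v.len_nonneg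
      toFun_ne_bot_iff := fun x => by
        have hu := u.len_nonneg
        have hv := v.len_nonneg
        split_ifs with h
        · rw [u.toFun_ne_bot_iff]
          constructor
          · rintro ⟨h1, h2⟩; exact ⟨h1, by linarith⟩
          · rintro ⟨h1, h2⟩; exact ⟨h1, h⟩
        · rw [v.toFun_ne_bot_iff]
          constructor
          · rintro ⟨h1, h2⟩; exact ⟨by linarith, by linarith⟩
          · rintro ⟨h1, h2⟩; exact ⟨by linarith, by linarith⟩
      finite_breaks := by
        obtain ⟨D, hD⟩ := u.finite_breaks
        obtain ⟨E, hE⟩ := v.finite_breaks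
        refine ⟨D ∪ (insert u.len (E.image fun e => u.len + e)), fun x y hx hxy hy h => ?_⟩
        have h1 : ¬ (x < u.len ∧ u.len ≤ y) := h _ (by simp)
        by_cases hyu : y < u.len
        · have hxu : x < u.len := lt_of_le_of_lt hxy hyu
          simp only [hyu, hxu, if_true]
          exact hD x y hx hxy hyu fun d hd => h d (by simp [hd])
        · have hxu : ¬ x < u.len := fun hc => h1 ⟨hc, not_lt.1 hyu⟩
          simp only [hyu, hxu, if_false]
          refine hE _ _ (by linarith) (by linarith) (by linarith) fun e he hc => ?_
          refine h (u.len + e) (by simp [he]) ⟨by linarith [hc.1], by linarith [hc.2]⟩ }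

@[simp] theorem len_one : (1 : TimedWord n).len = 0 := rfl

@[simp] theorem toFun_one (x : ℝ) : (1 : TimedWord n).toFun x = ⊥ := rfl

@[simp] theorem len_mul (u v : TimedWord n) : (u * v).len = u.len + v.len := rfl

open Classical in
theorem toFun_mul (u v : TimedWord n) (x : ℝ) :
    (u * v).toFun x = if x < u.len then u.toFun x else v.toFun (x - u.len) := rfl

/-- The monoid of timed words under concatenation. -/
noncomputable instance : Monoid (TimedWord n) where
  mul_assoc u v w := by
    apply ext_toFun
    funext x
    have hv := v.len_nonneg
    simp only [toFun_mul, len_mul]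
    by_cases h1 : x < u.len
    · have h2 : x < u.len + v.len := by linarith
      simp [h1, h2]
    · by_cases h2 : x < u.len + v.len
      · have h3 : x - u.len < v.len := by linarith
        simp [h1, h2, h3]
      · have h3 : ¬ x - u.len < v.len := by linarith
        simp [h1, h2, h3, sub_sub]
  one_mul u := by
    apply ext_toFun
    funext x
    simp only [toFun_mul, len_one, toFun_one, sub_zero]
    split_ifs with h
    · exact (u.toFun_eq_bot fun hc => absurd hc.1 (not_le.2 h)).symm
    · rfl
  mul_one u := by
    apply ext_toFun
    funext x
    simp only [toFun_mul, toFun_one]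
    split_ifs with h
    · rfl
    · exact (u.toFun_eq_bot fun hc => h hc.2).symm

open Classical in
/-- The timed word `c^t`. -/
noncomputable def pow (c : Fin n) (t : ℝ≥0) : TimedWord n where
  len := t
  toFun := fun x => if 0 ≤ x ∧ x < t then (c : WithBot (Fin n)) else ⊥
  len_nonneg := t.2
  toFun_ne_bot_iff x := by
    split_ifs with h <;> simp [h]
  finite_breaks := ⟨∅, fun x y hx hxy hy _ => by
    rw [if_pos ⟨hx, lt_of_le_of_lt hxy hy⟩, if_pos ⟨hx.trans hxy, hy⟩]⟩

open Classical in
/-- The segment `w_{[a, b)}` of `w`, for `0 ≤ a ≤ b ≤ l(w)` (the empty word for other `a`, `b`). -/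
noncomputable def slice (w : TimedWord n) (a b : ℝ) : TimedWord n where
  len := if 0 ≤ a ∧ a ≤ b ∧ b ≤ w.len then b - a else 0
  toFun := fun t =>
    if (0 ≤ a ∧ a ≤ b ∧ b ≤ w.len) ∧ 0 ≤ t ∧ t < b - a then w.toFun (a + t) else ⊥
  len_nonneg := by
    split_ifs with h
    · linarith [h.2.1]
    · exact le_rfl
  toFun_ne_bot_iff t := by
    by_cases h : 0 ≤ a ∧ a ≤ b ∧ b ≤ w.len
    · by_cases ht : 0 ≤ t ∧ t < b - a
      · have : w.toFun (a + t) ≠ ⊥ :=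
          (w.toFun_ne_bot_iff _).2 ⟨by linarith [h.1, ht.1], by linarith [h.2.2, ht.2]⟩
        simp only [h, ht, and_self, if_true]
        simpa using this
      · simp only [h, ht, and_false, if_false, and_self, if_true]
        simp
    · simp only [h, false_and, if_false]
      simp only [ne_eq, not_true_eq_false, false_iff, not_and, not_lt]
      exact fun h => h
  finite_breaks := by
    obtain ⟨D, hD⟩ := w.finite_breaks
    refine ⟨D.image fun d => d - a, fun x y hx hxy hy h => ?_⟩
    by_cases hab : 0 ≤ a ∧ a ≤ b ∧ b ≤ w.len
    · simp only [hab, and_self, if_true] at hy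
      have hx' : 0 ≤ x ∧ x < b - a := ⟨hx, lt_of_le_of_lt hxy hy⟩
      have hy' : 0 ≤ y ∧ y < b - a := ⟨hx.trans hxy, hy⟩
      simp only [hab, hx', hy', and_self, if_true]
      refine hD _ _ (by linarith [hab.1]) (by linarith) (by linarith [hab.2.2]) fun d hd hc => ?_
      exact h (d - a) (Finset.mem_image_of_mem _ hd) ⟨by linarith [hc.1], by linarith [hc.2]⟩
    · simp only [hab, false_and, if_false]

/-- The weight of `w`: `w.wt c` is the measure of the set where `w` takes the value `c`. -/
noncomputable def wt (w : TimedWord n) (c : Fin n) : ℝ≥0 :=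
  (volume {x : ℝ | w.toFun x = (c : WithBot (Fin n))}).toNNReal

/-- Timed rows: weakly increasing timed words. -/
def IsRow (w : TimedWord n) : Prop :=
  ∀ x y, 0 ≤ x → x ≤ y → y < w.len → w.toFun x ≤ w.toFun y

/-- `u.DominatedBy v` is the relation `u ◁ v` between timed rows. -/
def DominatedBy (u v : TimedWord n) : Prop :=
  v.len ≤ u.len ∧ ∀ t, 0 ≤ t → t < v.len → u.toFun t < v.toFun t

/-- `L = [u_l, …, u_1]` is the row decomposition `w = u_l ⋯ u_1` of `w`: each `u_i` is a non-empty
timed row and no `u_i u_{i-1}` is a row.  The empty word has the empty row decomposition. -/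
def IsRowDecomposition (w : TimedWord n) (L : List (TimedWord n)) : Prop :=
  L.prod = w ∧ (∀ u ∈ L, 0 < u.len ∧ u.IsRow) ∧ L.IsChain fun u v => ¬ (u * v).IsRow

theorem eq_one_of_len (w : TimedWord n) (h : w.len = 0) : w = 1 := by
  apply ext_toFun
  funext x
  exact w.toFun_eq_bot fun hc => by linarith [hc.1, hc.2]

theorem slice_mul_slice (w : TimedWord n) {d : ℝ} (h0 : 0 ≤ d) (h1 : d ≤ w.len) :
    w.slice 0 d * w.slice d w.len = w := by
  apply ext_toFun
  funext x
  have hl : (w.slice 0 d).len = d := by simp [slice, h0, h1]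
  rw [toFun_mul, hl]
  split_ifs with h
  · by_cases hx : 0 ≤ x
    · simp [slice, h0, h1, hx, h]
    · rw [toFun_eq_bot, toFun_eq_bot] <;> exact fun hc => hx hc.1
  · by_cases hx : x < w.len
    · simp [slice, h0, h1, hx, not_lt.1 h]
    · rw [toFun_eq_bot, toFun_eq_bot]
      · exact fun hc => hx hc.2
      · intro hc
        have := hc.2
        simp only [slice, h0, h1, le_refl, and_self, if_true] at this
        exact hx (by linarith)

/-- Every timed word has an exponential string `c_1^{t_1} ⋯ c_k^{t_k}` with positive exponents. -/
theorem exists_expString (w : TimedWord n) :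
    ∃ L : List (Fin n × ℝ≥0), (∀ p ∈ L, 0 < p.2) ∧ (L.map fun p => pow p.1 p.2).prod = w := by
  obtain ⟨D, hD⟩ := w.finite_breaks
  induction hm : D.card generalizing w D with
  | zero =>
    rcases w.len_nonneg.eq_or_lt with h | h
    · exact ⟨[], by simp, by simpa using (w.eq_one_of_len h.symm).symm⟩
    · obtain ⟨c, hc⟩ := WithBot.ne_bot_iff_exists.1 ((w.toFun_ne_bot_iff 0).2 ⟨le_rfl, h⟩)
      refine ⟨[(c, ⟨w.len, h.le⟩)], fun p hp => by rw [List.mem_singleton.1 hp]; exact h, ?_⟩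
      rw [List.map_singleton, List.prod_singleton]
      apply ext_toFun
      funext x
      have hD0 : D = ∅ := Finset.card_eq_zero.1 hm
      by_cases hx : 0 ≤ x ∧ x < w.len
      · have := hD 0 x le_rfl hx.1 hx.2 (by simp [hD0])
        rw [← this, ← hc]
        exact if_pos hx
      · rw [toFun_eq_bot, toFun_eq_bot] <;> exact hx
  | succ m ih =>
    obtain ⟨d, hd⟩ := Finset.card_pos.1 (by omega : 0 < D.card)
    -- choose the largest break
    set d := D.max' ⟨d, hd⟩ with hdef
    have hdD : d ∈ D := D.max'_mem _
    have hmax : ∀ e ∈ D, e ≤ d := fun e he => D.le_max' e he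
    have hcard : (D.erase d).card = m := by rw [Finset.card_erase_of_mem hdD]; omega
    by_cases hin : 0 < d ∧ d < w.len
    · have hl : (w.slice 0 d).len = d := by simp [slice, hin.1.le, hin.2.le]
      have hl2 : (w.slice d w.len).len = w.len - d := by simp [slice, hin.1.le, hin.2.le]
      obtain ⟨L, hL, hLw⟩ := ih (w.slice 0 d) (D.erase d) (by
        intro x y hx hxy hy h
        rw [hl] at hy
        have hx' : x < d := lt_of_le_of_lt hxy hy
        simp only [slice, hin.1.le, hin.2.le, le_refl, true_and, hx, hx.trans hxy, sub_zero, hx', hy,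
          and_self, if_true, zero_add]
        refine hD x y hx hxy (hy.trans hin.2) fun e he hc => ?_
        by_cases hed : e = d
        · subst hed; linarith [hc.2]
        · exact h e (Finset.mem_erase.2 ⟨hed, he⟩) hc) hcard
      obtain ⟨c, hc⟩ := WithBot.ne_bot_iff_exists.1 ((w.toFun_ne_bot_iff d).2 ⟨hin.1.le, hin.2⟩)
      have hpos : 0 < w.len - d := by linarith [hin.2]
      refine ⟨L ++ [(c, ⟨w.len - d, hpos.le⟩)], ?_, ?_⟩
      · intro p hp
        rcases List.mem_append.1 hp with hp | hp
        · exact hL p hp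
        · rw [List.mem_singleton.1 hp]; exact hpos
      · rw [List.map_append, List.prod_append, hLw]
        conv_rhs => rw [← w.slice_mul_slice hin.1.le hin.2.le]
        congr 1
        simp only [List.map_cons, List.map_nil, List.prod_cons, List.prod_nil, mul_one]
        apply ext_toFun
        funext x
        by_cases hx : 0 ≤ x ∧ x < w.len - d
        · have := hD d (d + x) hin.1.le (by linarith [hx.1]) (by linarith [hx.2])
            fun e he hc => by linarith [hmax e he, hc.1]
          have h1 : (w.slice d w.len).toFun x = w.toFun (d + x) := by
            simp [slice, hx.1, hx.2, hin.1.le, hin.2.le]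
          rw [h1, ← this, ← hc]
          exact if_pos hx
        · rw [toFun_eq_bot, toFun_eq_bot]
          · rw [hl2]; exact hx
          · exact hx
    · refine ih w (D.erase d) (fun x y hx hxy hy h => hD x y hx hxy hy fun e he hc => ?_) hcard
      by_cases hed : e = d
      · rw [hed] at hc
        exact hin ⟨lt_of_le_of_lt hx hc.1, lt_of_le_of_lt hc.2 hy⟩
      · exact h e (Finset.mem_erase.2 ⟨hed, he⟩) hc

theorem isRow_pow (c : Fin n) (t : ℝ≥0) : (pow c t).IsRow := by
  intro x y hx hxy hy
  have hy' : y < t := hy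
  simp [pow, hx, hx.trans hxy, hy', lt_of_le_of_lt hxy hy']

theorem IsRow.right {u v : TimedWord n} (h : (u * v).IsRow) : v.IsRow := by
  intro x y hx hxy hy
  have hu := u.len_nonneg
  have := h (u.len + x) (u.len + y) (by linarith) (by linarith) (by rw [len_mul]; linarith)
  rw [toFun_mul, toFun_mul, if_neg (by linarith), if_neg (by linarith)] at this
  simpa using this

theorem exists_isRowDecomposition (w : TimedWord n) : ∃ L, w.IsRowDecomposition L := by
  obtain ⟨E, hE, rfl⟩ := w.exists_expString
  induction E with
  | nil => exact ⟨[], by simp [IsRowDecomposition]⟩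
  | cons p E ih =>
    obtain ⟨L, hprod, hrow, hch⟩ := ih fun q hq => hE q (List.mem_cons_of_mem _ hq)
    have hp : 0 < (pow p.1 p.2).len := hE p List.mem_cons_self
    simp only [List.map_cons, List.prod_cons]
    rw [← hprod]
    cases L with
    | nil => exact ⟨[pow p.1 p.2], by simp [IsRowDecomposition, hp, isRow_pow]⟩
    | cons r L =>
      by_cases hr : (pow p.1 p.2 * r).IsRow
      · refine ⟨(pow p.1 p.2 * r) :: L, by simp [mul_assoc], ?_, ?_⟩
        · intro u hu
          rcases List.mem_cons.1 hu with rfl | hu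
          · exact ⟨by rw [len_mul]; linarith [r.len_nonneg], hr⟩
          · exact hrow u (List.mem_cons_of_mem _ hu)
        · cases L with
          | nil => simp
          | cons s L =>
            rw [List.isChain_cons_cons] at hch ⊢
            exact ⟨fun hc => hch.1 (by rw [mul_assoc] at hc; exact hc.right), hch.2⟩
      · refine ⟨pow p.1 p.2 :: r :: L, by simp, ?_, ?_⟩
        · intro u hu
          rcases List.mem_cons.1 hu with rfl | hu
          · exact ⟨hp, isRow_pow _ _⟩
          · exact hrow u hu
        · rw [List.isChain_cons_cons]
          exact ⟨hr, hch⟩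

/-- If the first row of one decomposition is shorter than that of another one, then it could
have been prolonged. -/
theorem IsRowDecomposition.not_lt {u v : TimedWord n} {L M : List (TimedWord n)}
    (h : (u :: L).prod = (v :: M).prod) (hL : (u :: L).IsChain fun u v => ¬ (u * v).IsRow)
    (hrL : ∀ x ∈ u :: L, 0 < x.len ∧ x.IsRow) (hv : v.IsRow) : ¬ u.len < v.len := by
  intro hlt
  simp only [List.prod_cons] at h
  have hlen := congrArg len h
  simp only [len_mul] at hlen
  have hM := M.prod.len_nonneg
  have hu := u.len_nonneg
  have hfun : ∀ x, (u * L.prod).toFun x = (v * M.prod).toFun x := fun x => by rw [h]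
  cases L with
  | nil => simp at hlen; linarith
  | cons s L =>
    rw [List.isChain_cons_cons] at hL
    apply hL.1
    have hs := hrL s (by simp)
    have hur := hrL u (by simp)
    have hvu : ∀ x, x < u.len → v.toFun x = u.toFun x := fun x hx => by
      have := hfun x
      rw [toFun_mul, toFun_mul, if_pos hx, if_pos (hx.trans hlt)] at this
      exact this.symm
    have hvs : v.toFun u.len = s.toFun 0 := by
      have := hfun u.len
      rw [toFun_mul, toFun_mul, if_neg (lt_irrefl _), if_pos hlt, sub_self, List.prod_cons,
        toFun_mul, if_pos hs.1] at this
      exact this.symm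
    intro x y hx hxy hy
    rw [len_mul] at hy
    rw [toFun_mul, toFun_mul]
    by_cases hyu : y < u.len
    · rw [if_pos (lt_of_le_of_lt hxy hyu), if_pos hyu]
      exact hur.2 x y hx hxy hyu
    · rw [if_neg hyu]
      by_cases hxu : x < u.len
      · rw [if_pos hxu, ← hvu x hxu]
        refine (hv x u.len hx hxu.le hlt).trans ?_
        rw [hvs]
        exact hs.2 0 _ le_rfl (by linarith) (by linarith)
      · rw [if_neg hxu]
        exact hs.2 _ _ (by linarith) (by linarith) (by linarith)

theorem IsRowDecomposition.unique {w : TimedWord n} {L M : List (TimedWord n)}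
    (hL : w.IsRowDecomposition L) (hM : w.IsRowDecomposition M) : L = M := by
  obtain ⟨rfl, hL1, hL2⟩ := hL
  obtain ⟨hp, hM1, hM2⟩ := hM
  induction L generalizing M with
  | nil =>
    cases M with
    | nil => rfl
    | cons v M =>
      have := congrArg len hp
      simp only [List.prod_cons, len_mul, List.prod_nil, len_one] at this
      linarith [(hM1 v (by simp)).1, M.prod.len_nonneg]
  | cons u L ih =>
    cases M with
    | nil =>
      have := congrArg len hp
      simp only [List.prod_cons, len_mul, List.prod_nil, len_one] at this
      linarith [(hL1 u (by simp)).1, L.prod.len_nonneg]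
    | cons v M =>
      have h1 := IsRowDecomposition.not_lt hp.symm hL2 hL1 (hM1 v (by simp)).2
      have h2 := IsRowDecomposition.not_lt hp hM2 hM1 (hL1 u (by simp)).2
      have hl : u.len = v.len := le_antisymm (_root_.not_lt.1 h2) (_root_.not_lt.1 h1)
      simp only [List.prod_cons] at hp
      have hfun : ∀ x, (v * M.prod).toFun x = (u * L.prod).toFun x := fun x => by rw [hp]
      have huv : u = v := by
        apply ext_toFun
        funext x
        by_cases hx : x < u.len
        · have := hfun x
          rw [toFun_mul, toFun_mul, if_pos hx, if_pos (hl ▸ hx)] at this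
          exact this.symm
        · rw [toFun_eq_bot, toFun_eq_bot]
          · exact fun hc => hx (hl ▸ hc.2)
          · exact fun hc => hx hc.2
      subst huv
      have hrest : M.prod = L.prod := by
        apply ext_toFun
        funext x
        by_cases hx : 0 ≤ x
        · have := hfun (u.len + x)
          rw [toFun_mul, toFun_mul, if_neg (by linarith), if_neg (by linarith)] at this
          simpa using this
        · rw [toFun_eq_bot, toFun_eq_bot] <;> exact fun hc => hx hc.1
      rw [ih (fun x hx => hL1 x (by simp [hx])) hL2.tail hrest
        (fun x hx => hM1 x (by simp [hx])) hM2.tail]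

/-- The row decomposition `[u_l, …, u_1]` of `w = u_l ⋯ u_1`. -/
noncomputable def rowDecomposition (w : TimedWord n) : List (TimedWord n) :=
  w.exists_isRowDecomposition.choose

theorem rowDecomposition_spec (w : TimedWord n) : w.IsRowDecomposition w.rowDecomposition :=
  w.exists_isRowDecomposition.choose_spec

/-- Timed tableaux: `u_1 ◁ u_2 ◁ ⋯ ◁ u_l` for the row decomposition `w = u_l ⋯ u_1`. -/
def IsTableau (w : TimedWord n) : Prop :=
  w.rowDecomposition.IsChain fun u v => v.DominatedBy u

/-- The shape `(l(u_1), …, l(u_l))` of `w = u_l ⋯ u_1`. -/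
noncomputable def shape (w : TimedWord n) : List ℝ :=
  w.rowDecomposition.reverse.map len

open Classical in
/-- `RINS(u, c^t) = (v', u')`: insertion of `c^t` into the timed row `u`. -/
noncomputable def rinsLetter (u : TimedWord n) (c : Fin n) (t : ℝ≥0) :
    TimedWord n × TimedWord n :=
  if ∀ x, 0 ≤ x → x < u.len → u.toFun x ≤ (c : WithBot (Fin n)) then (1, u * pow c t)
  else
    let t₀ : ℝ := sInf {x : ℝ | 0 ≤ x ∧ x < u.len ∧ (c : WithBot (Fin n)) < u.toFun x}
    if (t : ℝ) < u.len - t₀ then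
      (u.slice t₀ (t₀ + t), u.slice 0 t₀ * pow c t * u.slice (t₀ + t) u.len)
    else (u.slice t₀ u.len, u.slice 0 t₀ * pow c t)

/-- Successive insertion of `c_1^{t_1}, …, c_k^{t_k}` into the timed row `u`; the words that are
bumped out are concatenated. -/
noncomputable def rinsString (u : TimedWord n) (E : List (Fin n × ℝ≥0)) :
    TimedWord n × TimedWord n :=
  E.foldl (fun q p => (q.1 * (rinsLetter q.2 p.1 p.2).1, (rinsLetter q.2 p.1 p.2).2)) (1, u)

/-- `RINS(u, v) = (v', u')` for timed rows `u` and `v`, where the row `v` is written as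
`1^{m_1} 2^{m_2} ⋯ n^{m_n}` with `(m_1, …, m_n)` the weight of `v`. -/
noncomputable def rins (u v : TimedWord n) : TimedWord n × TimedWord n :=
  rinsString u ((List.finRange n).map fun c => (c, v.wt c))

/-- `insertRows [u_1, …, u_l] v = v_l' u_l' ⋯ u_1'`, where `v_0' = v` and
`RINS(u_i, v_{i-1}') = (v_i', u_i')`. -/
noncomputable def insertRows : List (TimedWord n) → TimedWord n → TimedWord n
  | [], v => v
  | u :: us, v => insertRows us (rins u v).1 * (rins u v).2

/-- `INSERT(w, v)`: insertion of the timed row `v` into the timed tableau `w`. -/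
noncomputable def insert (w v : TimedWord n) : TimedWord n :=
  insertRows w.rowDecomposition.reverse v

/-- The insertion tableau `P(w) = INSERT(⋯ INSERT(INSERT(u_1, u_2), u_3) ⋯, u_l)`, where now the
row decomposition is written `w = u_1 u_2 ⋯ u_l`. -/
noncomputable def insertionTableau (w : TimedWord n) : TimedWord n :=
  match w.rowDecomposition with
  | [] => 1
  | u :: us => us.foldl insert u

/-- `S` is a finite disjoint union of intervals `[a, b)`. -/
def IsIntervalUnion (S : Set ℝ) : Prop :=
  ∃ F : Finset (ℝ × ℝ), (F : Set (ℝ × ℝ)).PairwiseDisjoint (fun p => Ico p.1 p.2) ∧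
    S = ⋃ p ∈ F, Ico p.1 p.2

/-- `v` is the timed subword `w_S`, for `S ⊆ [0, l(w))` a finite disjoint union of intervals
`[a, b)`: `v` has length `meas(S)`, and `v(t) = w(inf {x | meas([0, x) ∩ S) > t})`. -/
def IsSubwordAt (v w : TimedWord n) (S : Set ℝ) : Prop :=
  IsIntervalUnion S ∧ S ⊆ Ico 0 w.len ∧ v.len = volume.real S ∧
    ∀ t, 0 ≤ t → t < volume.real S →
      v.toFun t = w.toFun (sInf {x : ℝ | x ∈ Ico 0 w.len ∧ t < volume.real (Ico 0 x ∩ S)})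

/-- The total lengths of `k` pairwise disjoint timed subwords of `w` that are timed rows. -/
def rowSubwordLengths (w : TimedWord n) (k : ℕ) : Set ℝ :=
  {s | ∃ (u : Fin k → TimedWord n) (S : Fin k → Set ℝ),
    (∀ i, (u i).IsSubwordAt w (S i)) ∧ (∀ i j, i ≠ j → Disjoint (S i) (S j)) ∧
    (∀ i, (u i).IsRow) ∧ s = ∑ i, (u i).len}

/-- The `k`-th Greene invariant `a_k(w)`. -/
noncomputable def greeneInvariant (w : TimedWord n) (k : ℕ) : ℝ :=
  sSup (w.rowSubwordLengths k)

/-- Equality of real partitions: trailing zeroes are disregarded. -/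
def EqAsPartitions (lam mu : List ℝ) : Prop :=
  ∀ i, lam.getD i 0 = mu.getD i 0

end TimedWord

namespace TimedWord

variable {n : ℕ}

/-! The classical pattern carries over: the Greene invariants are stable under Knuth relations,
insertion is a composite of Knuth relations, and on a tableau the invariants are the sums of the
longest rows.

Continuity is no obstacle. A block `c^t` met by a chain may as well be handed to that chain
entirely, so the invariants of `c_1^{t_1} ⋯ c_r^{t_r}` are governed by the finite problem
`Achieves`, where each block is skipped or given to one of `k` chains.
`Achieves.exists_isChainFamily` and `IsChainFamily.achieves` translate between the two settings. The
level `σ i` of a chain is all that it remembers of its past; a relation valid for all levels and all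
continuations therefore holds in every context, which makes `GreeneEquiv` a congruence. The Knuth
relations are used with a whole row in place of one letter and equal exponents on the other two
(`achieves_knuth_right`, `achieves_knuth_left`); they are proved by rerouting chains.

That insertion yields tableaux is a matter of partial sums of weights. A row is determined by `cum`,
domination becomes a family of inequalities (`dominatedBy_iff`), and row insertion becomes the
max-plus recursion `insCum`; `DominatedBy.rins` is then an induction along the alphabet.

On a tableau `u_l ⋯ u_1` the first `k` rows are `k` chains, which gives the lower bound. Columns
strictly decrease in reading order, so a chain meets the column at time `t` at most once. Thus `k`
disjoint chains have at most `min(k, height)` points there, and the integral over `t` is the length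
of the first `k` rows (`IsChainFamily.sum_volume_le`). -/

/-- The total weights that `k` increasing chains can collect from the word `c_1^{t_1} ⋯ c_r^{t_r}`,
when the `i`-th chain may only use letters `≥ σ i`. -/
def Achieves {k : ℕ} : List (Fin n × ℝ≥0) → (Fin k → WithBot (Fin n)) → ℝ → Prop
  | [], _, g => g ≤ 0
  | p :: E, σ, g => Achieves E σ g ∨
      ∃ i, σ i ≤ (p.1 : WithBot (Fin n)) ∧ Achieves E (Function.update σ i p.1) (g - p.2)

/-! ### Chains in exponential strings and the Knuth relations. -/

section Achieves

variable {k : ℕ}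

theorem achieves_cons {p : Fin n × ℝ≥0} {E : List (Fin n × ℝ≥0)} {σ : Fin k → WithBot (Fin n)}
    {g : ℝ} : Achieves (p :: E) σ g ↔ Achieves E σ g ∨
      ∃ i, σ i ≤ (p.1 : WithBot (Fin n)) ∧ Achieves E (Function.update σ i p.1) (g - p.2) :=
  Iff.rfl

theorem Achieves.skip {p : Fin n × ℝ≥0} {E : List (Fin n × ℝ≥0)} {σ : Fin k → WithBot (Fin n)}
    {g : ℝ} (h : Achieves E σ g) : Achieves (p :: E) σ g :=
  Or.inl h

theorem Achieves.take {p : Fin n × ℝ≥0} {E : List (Fin n × ℝ≥0)} {σ : Fin k → WithBot (Fin n)}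
    {g : ℝ} (i : Fin k) (hi : σ i ≤ (p.1 : WithBot (Fin n)))
    (h : Achieves E (Function.update σ i p.1) (g - p.2)) : Achieves (p :: E) σ g :=
  Or.inr ⟨i, hi, h⟩

theorem Achieves.mono {E : List (Fin n × ℝ≥0)} {σ τ : Fin k → WithBot (Fin n)} {g h : ℝ}
    (H : Achieves E σ g) (hτ : τ ≤ σ) (hg : h ≤ g) : Achieves E τ h := by
  induction E generalizing σ τ g h with
  | nil => exact hg.trans H
  | cons p E ih =>
    rcases H with H | ⟨i, hi, H⟩
    · exact (ih H hτ hg).skip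
    · exact (ih H (update_le_update_iff.2 ⟨le_rfl, fun j _ => hτ j⟩)
        (by linarith)).take i ((hτ i).trans hi)

theorem Achieves.comp_perm {E : List (Fin n × ℝ≥0)} {σ : Fin k → WithBot (Fin n)} {g : ℝ}
    (H : Achieves E σ g) (π : Equiv.Perm (Fin k)) : Achieves E (σ ∘ π) g := by
  induction E generalizing σ g with
  | nil => exact H
  | cons p E ih =>
    rcases H with H | ⟨i, hi, H⟩
    · exact (ih H).skip
    · refine Achieves.take (π.symm i) (by simpa using hi) ?_
      have := ih H
      rwa [Function.update_comp_equiv] at this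

/-- Chains are interchangeable: only the multiset of levels matters, and levels may be lowered. -/
theorem Achieves.update_swap {E : List (Fin n × ℝ≥0)} {σ : Fin k → WithBot (Fin n)} {g : ℝ}
    {i j : Fin k} (hij : i ≠ j) {a b : WithBot (Fin n)}
    (H : Achieves E (Function.update (Function.update σ i a) j b) g)  {a' b' : WithBot (Fin n)}
    (ha : a' ≤ a) (hb : b' ≤ b) :
    Achieves E (Function.update (Function.update σ i b') j a') g := by
  refine (H.comp_perm (Equiv.swap i j)).mono (fun l => ?_) le_rfl
  by_cases hlj : l = j
  · subst hlj
    simpa [Function.update_of_ne hij] using ha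
  · by_cases hli : l = i
    · subst hli
      simpa [Function.update_of_ne hij] using hb
    · simp [Equiv.swap_apply_of_ne_of_ne hli hlj, hli, hlj]

/-- A prefix acts on what follows only through the levels and the remaining gain, so an equivalence
for all `σ` and `g` survives it. -/
theorem Achieves.append_congr {E F : List (Fin n × ℝ≥0)}
    (h : ∀ (σ : Fin k → WithBot (Fin n)) g, Achieves E σ g ↔ Achieves F σ g)
    (X : List (Fin n × ℝ≥0)) (σ : Fin k → WithBot (Fin n)) (g : ℝ) :
    Achieves (X ++ E) σ g ↔ Achieves (X ++ F) σ g := by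
  induction X generalizing σ g with
  | nil => exact h σ g
  | cons p X ih => simp only [List.cons_append, achieves_cons, ih]

theorem not_update_le {σ : Fin k → WithBot (Fin n)} {i : Fin k} {b c : Fin n} (h : c < b) :
    ¬ Function.update σ i (b : WithBot (Fin n)) i ≤ (c : WithBot (Fin n)) := by
  rw [Function.update_self, WithBot.coe_le_coe]
  exact not_le.2 h

/-- Letters taken by different chains may be exchanged. -/
theorem Achieves.swap {p q : Fin n × ℝ≥0} {E : List (Fin n × ℝ≥0)}
    {σ : Fin k → WithBot (Fin n)} {g : ℝ} (hpq : q.1 < p.1)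
    (H : Achieves (p :: q :: E) σ g) : Achieves (q :: p :: E) σ g := by
  rcases H with (H | ⟨i, hi, H⟩) | ⟨i, hi, (H | ⟨j, hj, H⟩)⟩
  · exact H.skip.skip
  · exact Achieves.take i hi H.skip
  · exact (Achieves.take i hi H).skip
  · have hij : j ≠ i := fun h => not_update_le hpq (h ▸ hj)
    rw [Function.update_of_ne hij] at hj
    refine Achieves.take j hj (Achieves.take i ?_ ?_)
    · rwa [Function.update_of_ne hij.symm]
    · rw [Function.update_comm hij]
      exact H.mono le_rfl (by linarith)

theorem Achieves.append_imp {E F : List (Fin n × ℝ≥0)}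
    (h : ∀ (σ : Fin k → WithBot (Fin n)) g, Achieves E σ g → Achieves F σ g)
    (X : List (Fin n × ℝ≥0)) {σ : Fin k → WithBot (Fin n)} {g : ℝ}
    (H : Achieves (X ++ E) σ g) : Achieves (X ++ F) σ g := by
  induction X generalizing σ g with
  | nil => exact h σ g H
  | cons p X ih =>
    rcases H with H | ⟨i, hi, H⟩
    · exact (ih H).skip
    · exact (ih H).take i hi

/-- Each step exchanges an adjacent descent, whose two letters never lie in the same chain. -/
theorem Achieves.move_left {c : Fin n} {t : ℝ≥0} {F E : List (Fin n × ℝ≥0)}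
    (hF : ∀ p ∈ F, c < p.1) {σ : Fin k → WithBot (Fin n)} {g : ℝ}
    (H : Achieves (F ++ (c, t) :: E) σ g) : Achieves ((c, t) :: (F ++ E)) σ g := by
  induction F generalizing σ g with
  | nil => exact H
  | cons p F ih =>
    refine Achieves.swap (hF p List.mem_cons_self) ?_
    exact Achieves.append_imp (X := [p])
      (fun σ g H => ih (fun q hq => hF q (List.mem_cons_of_mem _ hq)) H) H

theorem Achieves.move_right {b : Fin n} {t : ℝ≥0} {F E : List (Fin n × ℝ≥0)}
    (hF : ∀ p ∈ F, p.1 < b) {σ : Fin k → WithBot (Fin n)} {g : ℝ}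
    (H : Achieves ((b, t) :: (F ++ E)) σ g) : Achieves (F ++ (b, t) :: E) σ g := by
  induction F generalizing σ g with
  | nil => exact H
  | cons p F ih =>
    exact Achieves.append_imp (X := [p])
      (fun σ g H => ih (fun q hq => hF q (List.mem_cons_of_mem _ hq)) H)
      (Achieves.swap (hF p List.mem_cons_self) H)

/-- A chain that has just taken `c` either continues in `F`, in which case it could have taken
`b > c` instead, or it could have taken `c` after `F`. -/
theorem Achieves.bump_or_delay {b c : Fin n} {t : ℝ≥0} {F E : List (Fin n × ℝ≥0)}
    (hF : ∀ p ∈ F, b ≤ p.1) {σ : Fin k → WithBot (Fin n)} {g : ℝ} {j : Fin k}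
    (hj : σ j ≤ (c : WithBot (Fin n)))
    (H : Achieves (F ++ E) (Function.update σ j (c : WithBot (Fin n))) g) :
    Achieves (F ++ E) (Function.update σ j (b : WithBot (Fin n))) g ∨
      Achieves (F ++ (c, t) :: E) σ (g + t) := by
  induction F generalizing σ g with
  | nil => exact Or.inr (Achieves.take j hj (H.mono le_rfl (by simp)))
  | cons p F ih =>
    have hF' : ∀ q ∈ F, b ≤ q.1 := fun q hq => hF q (List.mem_cons_of_mem _ hq)
    rcases H with H | ⟨i, hi, H⟩
    · exact (ih hF' hj H).imp Achieves.skip Achieves.skip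
    · by_cases hij : i = j
      · subst hij
        refine Or.inl (Achieves.take i ?_ ?_)
        · rw [Function.update_self]
          exact WithBot.coe_le_coe.2 (hF p List.mem_cons_self)
        · rwa [Function.update_idem] at H ⊢
      · rw [Function.update_of_ne hij] at hi
        rw [Function.update_comm (Ne.symm hij)] at H
        refine (ih hF' (by rwa [Function.update_of_ne (Ne.symm hij)]) H).imp (fun H => ?_)
          fun H => ?_
        · refine Achieves.take i (by rwa [Function.update_of_ne hij]) ?_
          rwa [Function.update_comm (Ne.symm hij)]
        · exact Achieves.take i hi (H.mono le_rfl (by linarith))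

/-- If one chain has level `b`, it can do all the work of another chain in a row with letters
`≥ b`; the other chain is then free to take `c` afterwards. -/
theorem Achieves.delay {b c : Fin n} (hcb : c ≤ b) {t : ℝ≥0} {F E : List (Fin n × ℝ≥0)}
    (hF : ∀ p ∈ F, b ≤ p.1) (hs : F.Pairwise fun p q => p.1 ≤ q.1)
    {σ : Fin k → WithBot (Fin n)} {g : ℝ} {i j : Fin k} (hij : i ≠ j)
    (hj : σ j ≤ (c : WithBot (Fin n)))
    (H : Achieves (F ++ E) (Function.update (Function.update σ i (b : WithBot (Fin n))) j
      (c : WithBot (Fin n))) g) :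
    Achieves (F ++ (c, t) :: E) (Function.update σ i (b : WithBot (Fin n))) (g + t) := by
  induction F generalizing σ g b with
  | nil =>
    refine Achieves.take j ?_ (H.mono le_rfl (by simp))
    rwa [Function.update_of_ne hij.symm]
  | cons p F ih =>
    have hF' : ∀ q ∈ F, b ≤ q.1 := fun q hq => hF q (List.mem_cons_of_mem _ hq)
    have hbp := hF p List.mem_cons_self
    have hs' := List.pairwise_cons.1 hs
    rcases H with H | ⟨l, hl, H⟩
    · exact (ih hcb hF' hs'.2 hj H).skip
    · by_cases hli : l = i ∨ l = j
      · refine Achieves.take i (by rw [Function.update_self]; exact WithBot.coe_le_coe.2 hbp) ?_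
        rw [Function.update_idem]
        refine (ih (hcb.trans hbp) hs'.1 hs'.2 hj (g := g - p.2) ?_).mono le_rfl (by linarith)
        rcases hli with rfl | rfl
        · rwa [Function.update_comm hij.symm, Function.update_idem] at H
        · rw [Function.update_idem] at H
          -- Here chain `j` took the block. Exchanging the two chains puts `i` at level `p.1` and
          -- `j` at level `b`, which may be lowered to `c`.
          exact H.update_swap hij (WithBot.coe_le_coe.2 hcb) le_rfl
      · obtain ⟨hli, hlj⟩ := not_or.1 hli
        rw [Function.update_of_ne hlj, Function.update_of_ne hli] at hl
        refine Achieves.take l (by rwa [Function.update_of_ne hli]) ?_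
        rw [Function.update_comm (Ne.symm hli)]
        refine (ih hcb hF' hs'.2 (σ := Function.update σ l p.1) ?_ (g := g - p.2) ?_).mono le_rfl
          (by linarith)
        · rwa [Function.update_of_ne (Ne.symm hlj)]
        · rwa [Function.update_comm hli, Function.update_comm hlj]

/-- The Knuth relation `y z x ≡ y x z` for `x < y ≤ z`, with a row in the place of `z`. -/
theorem achieves_knuth_right {b c : Fin n} (hcb : c < b) (t : ℝ≥0) {F : List (Fin n × ℝ≥0)}
    (hF : ∀ p ∈ F, b ≤ p.1) (hs : F.Pairwise fun p q => p.1 ≤ q.1) (E : List (Fin n × ℝ≥0))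
    (σ : Fin k → WithBot (Fin n)) (g : ℝ) :
    Achieves ((b, t) :: (F ++ (c, t) :: E)) σ g ↔
      Achieves ((b, t) :: (c, t) :: (F ++ E)) σ g := by
  constructor
  · exact Achieves.append_imp (X := [(b, t)])
      fun σ g => Achieves.move_left fun p hp => hcb.trans_le (hF p hp)
  · rintro ((H | ⟨j, hj, H⟩) | ⟨i, hi, (H | ⟨j, hj, H⟩)⟩)
    · exact (Achieves.append_imp (fun _ _ => Achieves.skip) F H).skip
    -- The block `c^t` is taken and `b^t` is not: the chain takes `b^t` instead, at equal gain, or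
    -- waits for `c^t` behind `F`.
    · rcases Achieves.bump_or_delay (t := t) hF hj H with H | H
      · exact Achieves.take j (hj.trans (WithBot.coe_le_coe.2 hcb.le))
          (Achieves.append_imp (fun _ _ => Achieves.skip) F H)
      · exact (H.mono le_rfl (by simp)).skip
    · exact (Achieves.append_imp (fun _ _ => Achieves.skip) F H).take i hi
    · have hji : j ≠ i := fun h => not_update_le hcb (h ▸ hj)
      rw [Function.update_of_ne hji] at hj
      -- Both blocks are taken, by different chains: chain `i` does the work of both in `F`, and
      -- chain `j` waits for `c^t`.
      exact Achieves.take i hi ((H.delay (t := t) hcb.le hF hs hji.symm hj).mono le_rfl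
        (by simp))

/-- At level `b > c`, chain `i` is idle throughout `F` and `c^t`. Put back to level `a`, it can pick
up `c^t` if nobody takes it. Otherwise it takes over the work in `F` and `c^t` of the chain `l` that
takes `c^t`, while `l` moves to level `b` and continues the former course of `i`. -/
theorem Achieves.reassign {a b c : Fin n} (hac : a ≤ c) (hcb : c < b) {t : ℝ≥0}
    {F E : List (Fin n × ℝ≥0)} (hFa : ∀ p ∈ F, a ≤ p.1) (hFc : ∀ p ∈ F, p.1 ≤ c)
    (hs : F.Pairwise fun p q => p.1 ≤ q.1) {σ : Fin k → WithBot (Fin n)} {g : ℝ} {i : Fin k}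
    (H : Achieves (F ++ (c, t) :: E) (Function.update σ i (b : WithBot (Fin n))) g) :
    Achieves (F ++ (c, t) :: E) (Function.update σ i (a : WithBot (Fin n))) (g + t) ∨
      ∃ l, l ≠ i ∧ σ l ≤ (c : WithBot (Fin n)) ∧ Achieves (F ++ (c, t) :: E)
        (Function.update (Function.update σ i (a : WithBot (Fin n))) l
          (b : WithBot (Fin n))) g := by
  induction F generalizing σ g a with
  | nil =>
    rcases H with H | ⟨l, hl, H⟩
    · refine Or.inl (Achieves.take i ?_ ?_)
      · rw [Function.update_self]; exact WithBot.coe_le_coe.2 hac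
      · rw [Function.update_idem]
        exact H.mono (update_le_update_iff.2 ⟨WithBot.coe_le_coe.2 hcb.le, fun _ _ => le_rfl⟩)
          (by simp)
    · have hli : l ≠ i := fun h => not_update_le hcb (h ▸ hl)
      rw [Function.update_of_ne hli] at hl
      refine Or.inr ⟨l, hli, hl, Achieves.take i ?_ ?_⟩
      · rw [Function.update_of_ne hli.symm, Function.update_self]
        exact WithBot.coe_le_coe.2 hac
      · rw [Function.update_comm hli, Function.update_idem]
        exact H.update_swap hli.symm le_rfl le_rfl
  | cons p F ih =>
    have hFa' : ∀ q ∈ F, a ≤ q.1 := fun q hq => hFa q (List.mem_cons_of_mem _ hq)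
    have hFc' : ∀ q ∈ F, q.1 ≤ c := fun q hq => hFc q (List.mem_cons_of_mem _ hq)
    have hap := hFa p List.mem_cons_self
    have hpc := hFc p List.mem_cons_self
    have hs' := List.pairwise_cons.1 hs
    rcases H with H | ⟨m, hm, H⟩
    · exact (ih hac hFa' hFc' hs'.2 H).imp Achieves.skip
        fun ⟨l, h1, h2, h3⟩ => ⟨l, h1, h2, h3.skip⟩
    · have hmi : m ≠ i := fun h => not_update_le (hpc.trans_lt hcb) (h ▸ hm)
      rw [Function.update_of_ne hmi] at hm
      rw [Function.update_comm hmi.symm] at H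
      refine (ih hpc hs'.1 hFc' hs'.2 H).imp (fun H => ?_) ?_
      · refine Achieves.take m (by rwa [Function.update_of_ne hmi]) (H.mono ?_ (by linarith))
        rw [Function.update_comm hmi.symm]
        exact update_le_update_iff.2 ⟨WithBot.coe_le_coe.2 hap, fun _ _ => le_rfl⟩
      · rintro ⟨l, hli, hl, H⟩
        -- If `l` is the chain that took `p`, chain `i` must take `p` in its place; this is why the
        -- induction hypothesis was used with `p.1` instead of `a`.
        by_cases hlm : l = m
        · subst hlm
          refine ⟨l, hli, hm.trans (WithBot.coe_le_coe.2 hpc), Achieves.take i ?_ ?_⟩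
          · rw [Function.update_of_ne hli.symm, Function.update_self]
            exact WithBot.coe_le_coe.2 hap
          · rw [Function.update_comm hli, Function.update_idem]
            rwa [Function.update_comm hli.symm, Function.update_idem,
              Function.update_comm hli] at H
        · rw [Function.update_of_ne hlm] at hl
          refine ⟨l, hli, hl, Achieves.take m ?_ (H.mono ?_ le_rfl)⟩
          · rwa [Function.update_of_ne (Ne.symm hlm), Function.update_of_ne hmi]
          · rw [Function.update_comm hlm, Function.update_comm hmi.symm]
            exact update_le_update_iff.2 ⟨le_rfl, fun _ _ => update_le_update_iff.2
              ⟨WithBot.coe_le_coe.2 hap, fun _ _ => le_rfl⟩ _⟩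

/-- The Knuth relation `x z y ≡ z x y` for `x ≤ y < z`, with a row in the place of `x`. -/
theorem achieves_knuth_left {b c : Fin n} (hcb : c < b) (t : ℝ≥0) {F : List (Fin n × ℝ≥0)}
    (hF : ∀ p ∈ F, p.1 ≤ c) (hs : F.Pairwise fun p q => p.1 ≤ q.1) (E : List (Fin n × ℝ≥0))
    (σ : Fin k → WithBot (Fin n)) (g : ℝ) :
    Achieves (F ++ (b, t) :: (c, t) :: E) σ g ↔
      Achieves ((b, t) :: (F ++ (c, t) :: E)) σ g := by
  refine ⟨fun H => ?_, Achieves.move_right fun p hp => (hF p hp).trans_lt hcb⟩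
  induction F generalizing σ g with
  | nil => exact H
  | cons p F ih =>
    have hF' : ∀ q ∈ F, q.1 ≤ c := fun q hq => hF q (List.mem_cons_of_mem _ hq)
    have hpc := hF p List.mem_cons_self
    have hs' := List.pairwise_cons.1 hs
    rcases H with H | ⟨i, hi, H⟩
    · rcases ih hF' hs'.2 _ _ H with H | ⟨j, hj, H⟩
      · exact H.skip.skip
      · exact H.skip.take j hj
    · rcases ih hF' hs'.2 _ _ H with H | ⟨j, hj, H⟩
      · exact (H.take i hi).skip
      · by_cases hji : j = i
        · subst hji
          rw [Function.update_idem] at H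
          -- Chain `j` took both `p` and `b^t`. Left at the level of `p`, it gains `c^t` to make up
          -- for `b^t`, or another chain `l` can take `b^t` ahead of `p`.
          rcases H.reassign hpc hcb hs'.1 hF' hs'.2 with H | ⟨l, hlj, hl, H⟩
          · exact (Achieves.take j hi (H.mono le_rfl (by simp))).skip
          · refine Achieves.take l (hl.trans (WithBot.coe_le_coe.2 hcb.le))
              (Achieves.take j ?_ ?_)
            · rwa [Function.update_of_ne hlj.symm]
            · rw [Function.update_comm hlj]
              exact H.mono le_rfl (by simp only; linarith)
        · rw [Function.update_of_ne hji] at hj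
          refine Achieves.take j hj (Achieves.take i ?_ ?_)
          · rwa [Function.update_of_ne (Ne.symm hji)]
          · rw [Function.update_comm hji]
            exact H.mono le_rfl (by simp only; linarith)

end Achieves

/-! ### Timed words as products of blocks. -/

section Basic

theorem toFun_mul_of_lt (u v : TimedWord n) {x : ℝ} (h : x < u.len) :
    (u * v).toFun x = u.toFun x := by
  rw [toFun_mul, if_pos h]

theorem toFun_mul_of_le (u v : TimedWord n) {x : ℝ} (h : u.len ≤ x) :
    (u * v).toFun x = v.toFun (x - u.len) := by
  rw [toFun_mul, if_neg (not_lt.2 h)]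

theorem toFun_mul_add (u v : TimedWord n) {x : ℝ} (h : 0 ≤ x) :
    (u * v).toFun (u.len + x) = v.toFun x := by
  rw [toFun_mul_of_le u v (by linarith), add_sub_cancel_left]

@[simp] theorem len_pow (c : Fin n) (t : ℝ≥0) : (pow c t).len = t := rfl

theorem toFun_pow {c : Fin n} {t : ℝ≥0} {x : ℝ} (h0 : 0 ≤ x) (h1 : x < t) :
    (pow c t).toFun x = c :=
  if_pos ⟨h0, h1⟩

/-- The timed word with exponential string `E`. -/
noncomputable def ofString (E : List (Fin n × ℝ≥0)) : TimedWord n :=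
  (E.map fun p => pow p.1 p.2).prod

@[simp] theorem ofString_nil : ofString ([] : List (Fin n × ℝ≥0)) = 1 := rfl

@[simp] theorem ofString_cons (p : Fin n × ℝ≥0) (E : List (Fin n × ℝ≥0)) :
    ofString (p :: E) = pow p.1 p.2 * ofString E := by
  simp [ofString]

@[simp] theorem ofString_append (E F : List (Fin n × ℝ≥0)) :
    ofString (E ++ F) = ofString E * ofString F := by
  simp [ofString]

theorem exists_ofString (w : TimedWord n) : ∃ E, ofString E = w :=
  let ⟨E, _, h⟩ := w.exists_expString
  ⟨E, h⟩

end Basic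

/-! ### Finite unions of half-open intervals. -/

section IsIntervalUnion

theorem isIntervalUnion_empty : IsIntervalUnion ∅ := ⟨∅, by simp, by simp⟩

theorem isIntervalUnion_Ico (a b : ℝ) : IsIntervalUnion (Ico a b) := ⟨{(a, b)}, by simp, by simp⟩

theorem IsIntervalUnion.union {S T : Set ℝ} (hS : IsIntervalUnion S) (hT : IsIntervalUnion T)
    (h : Disjoint S T) : IsIntervalUnion (S ∪ T) := by
  classical
  obtain ⟨F, hF, rfl⟩ := hS
  obtain ⟨G, hG, rfl⟩ := hT
  refine ⟨F ∪ G, ?_, ?_⟩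
  · rw [Finset.coe_union, Set.pairwiseDisjoint_union]
    refine ⟨hF, hG, fun p hp q hq _ => h.mono ?_ ?_⟩
    · exact Set.subset_biUnion_of_mem (u := fun p : ℝ × ℝ => Ico p.1 p.2) hp
    · exact Set.subset_biUnion_of_mem (u := fun p : ℝ × ℝ => Ico p.1 p.2) hq
  · rw [Finset.set_biUnion_union]

theorem IsIntervalUnion.image_add {S : Set ℝ} (hS : IsIntervalUnion S) (t : ℝ) :
    IsIntervalUnion ((fun x => t + x) '' S) := by
  classical
  obtain ⟨F, hF, rfl⟩ := hS
  refine ⟨F.image fun p => (t + p.1, t + p.2), ?_, ?_⟩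
  · rintro _ hp _ hq hpq
    rw [Finset.coe_image] at hp hq
    obtain ⟨p, hp, rfl⟩ := hp
    obtain ⟨q, hq, rfl⟩ := hq
    have : p ≠ q := fun h => hpq (by rw [h])
    have := hF hp hq this
    simp only [Function.onFun, ← Set.image_const_add_Ico] at this ⊢
    exact (Set.disjoint_image_iff (add_right_injective t)).2 this
  · rw [Set.image_iUnion₂, Finset.set_biUnion_finset_image]
    simp only [Set.image_const_add_Ico]

theorem IsIntervalUnion.measurableSet {S : Set ℝ} (hS : IsIntervalUnion S) : MeasurableSet S := by
  obtain ⟨F, hF, rfl⟩ := hS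
  exact Finset.measurableSet_biUnion _ fun _ _ => measurableSet_Ico

/-- Half-open intervals make `S` open to the right, and likewise its complement in
`exists_Ico_disjoint`. Hence the measure of `S` up to `x` grows strictly to the right of points of
`S` and is locally constant to the right of other points. -/
theorem IsIntervalUnion.exists_Ico_subset {S : Set ℝ} (hS : IsIntervalUnion S) {x : ℝ}
    (hx : x ∈ S) : ∃ y, x < y ∧ Ico x y ⊆ S := by
  obtain ⟨F, hF, rfl⟩ := hS
  obtain ⟨p, hp, hx⟩ := Set.mem_iUnion₂.1 hx
  exact ⟨p.2, hx.2, fun z hz => Set.mem_iUnion₂.2 ⟨p, hp, hx.1.trans hz.1, hz.2⟩⟩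

theorem IsIntervalUnion.exists_Ico_disjoint {S : Set ℝ} (hS : IsIntervalUnion S) {x : ℝ}
    (hx : x ∉ S) : ∃ y, x < y ∧ Disjoint (Ico x y) S := by
  obtain ⟨F, hF, rfl⟩ := hS
  clear hF
  induction F using Finset.induction_on with
  | empty => exact ⟨x + 1, by linarith, by simp⟩
  | insert p F _ ih =>
    rw [Finset.set_biUnion_insert] at hx ⊢
    obtain ⟨y, hy, hd⟩ := ih fun h => hx (Or.inr h)
    have hp : x ∉ Ico p.1 p.2 := fun h => hx (Or.inl h)
    by_cases h : x < p.1
    · refine ⟨min y p.1, lt_min hy h, Set.disjoint_union_right.2 ⟨?_, ?_⟩⟩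
      · exact Set.disjoint_left.2 fun z hz hz' =>
          absurd (hz.2.trans_le (min_le_right _ _)) (not_lt.2 hz'.1)
      · exact hd.mono_left (Set.Ico_subset_Ico_right (min_le_left _ _))
    · refine ⟨y, hy, Set.disjoint_union_right.2 ⟨?_, hd⟩⟩
      exact Set.disjoint_left.2 fun z hz hz' => hp ⟨not_lt.1 h, hz.1.trans_lt hz'.2⟩

end IsIntervalUnion

/-! ### Disjoint chains in timed words, and their reduction to `Achieves`. -/

section ChainFamily

variable {k : ℕ}

/-- Pairwise disjoint sets of positions of `w`, on which `w` is weakly increasing with letters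
`≥ σ i`. -/
structure IsChainFamily (w : TimedWord n) (σ : Fin k → WithBot (Fin n)) (S : Fin k → Set ℝ) :
    Prop where
  subset : ∀ i, S i ⊆ Ico 0 w.len
  disjoint : ∀ i j, i ≠ j → Disjoint (S i) (S j)
  monotoneOn : ∀ i, MonotoneOn w.toFun (S i)
  level : ∀ i, ∀ x ∈ S i, σ i ≤ w.toFun x

theorem IsChainFamily.image_add {w : TimedWord n} {σ : Fin k → WithBot (Fin n)}
    {S : Fin k → Set ℝ} (h : IsChainFamily w σ S) (u : TimedWord n) :
    IsChainFamily (u * w) σ fun i => (fun x => u.len + x) '' S i where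
  subset i := by
    rintro _ ⟨x, hx, rfl⟩
    have := h.subset i hx
    have hu := u.len_nonneg
    exact ⟨by simp only; linarith [this.1], by simp only [len_mul]; linarith [this.2]⟩
  disjoint i j hij := (Set.disjoint_image_iff (add_right_injective _)).2 (h.disjoint i j hij)
  monotoneOn i := by
    rintro _ ⟨x, hx, rfl⟩ _ ⟨y, hy, rfl⟩ hxy
    simp only
    rw [toFun_mul_add _ _ (h.subset i hx).1, toFun_mul_add _ _ (h.subset i hy).1]
    exact h.monotoneOn i hx hy (by simpa using hxy)
  level i := by
    rintro _ ⟨x, hx, rfl⟩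
    simp only
    rw [toFun_mul_add _ _ (h.subset i hx).1]
    exact h.level i x hx

/-- A chain of `w` that only uses letters `≥ u` can be prolonged by the row `u`. -/
theorem IsChainFamily.union {w u : TimedWord n} {σ τ : Fin k → WithBot (Fin n)}
    {S : Fin k → Set ℝ} (h : IsChainFamily w τ S) (hu : u.IsRow) (i : Fin k)
    (hστ : ∀ j, σ j ≤ τ j) (hi : ∀ x, 0 ≤ x → x < u.len → σ i ≤ u.toFun x)
    (hi' : ∀ x, 0 ≤ x → x < u.len → ∀ y ∈ S i, u.toFun x ≤ w.toFun y) :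
    IsChainFamily (u * w) σ fun j =>
      (if j = i then Ico 0 u.len else ∅) ∪ (fun x => u.len + x) '' S j where
  subset j := by
    refine Set.union_subset ?_ ((h.image_add u).subset j)
    split_ifs
    · exact Set.Ico_subset_Ico_right (by simp [w.len_nonneg])
    · exact Set.empty_subset _
  disjoint j l hjl := by
    have key : ∀ j l, Disjoint (if j = i then Ico 0 u.len else ∅)
        ((fun x => u.len + x) '' S l) := by
      intro j l
      split_ifs
      · refine Set.disjoint_left.2 ?_
        rintro _ hx ⟨x, hx', rfl⟩
        have := (h.subset l hx').1
        have := hx.2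
        simp only at this
        linarith
      · exact Set.empty_disjoint _
    refine Set.disjoint_union_left.2 ⟨Set.disjoint_union_right.2 ⟨?_, key j l⟩,
      Set.disjoint_union_right.2 ⟨(key l j).symm, (h.image_add u).disjoint j l hjl⟩⟩
    split_ifs with h1 h2
    · exact absurd (h1.trans h2.symm) hjl
    all_goals simp
  monotoneOn j := by
    by_cases hj : j = i
    · subst hj
      simp only [if_true]
      rintro x (hx | hx) y (hy | hy) hxy
      · rw [toFun_mul_of_lt _ _ hx.2, toFun_mul_of_lt _ _ hy.2]
        exact hu x y hx.1 hxy hy.2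
      · obtain ⟨y, hy, rfl⟩ := hy
        simp only
        rw [toFun_mul_of_lt _ _ hx.2, toFun_mul_add _ _ (h.subset j hy).1]
        exact hi' x hx.1 hx.2 y hy
      · obtain ⟨x, hx, rfl⟩ := hx
        have := (h.subset j hx).1
        have := hy.2
        simp only at hxy
        linarith
      · exact (h.image_add u).monotoneOn j hx hy hxy
    · simp only [hj, if_false, Set.empty_union]
      exact (h.image_add u).monotoneOn j
  level j := by
    rintro x (hx | hx)
    · split_ifs at hx with hj
      · subst hj
        rw [toFun_mul_of_lt _ _ hx.2]
        exact hi x hx.1 hx.2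
      · exact absurd hx (Set.notMem_empty _)
    · exact (hστ j).trans ((h.image_add u).level j x hx)

theorem volume_real_image_add (t : ℝ) (S : Set ℝ) :
    volume.real ((fun x => t + x) '' S) = volume.real S := by
  rw [measureReal_def, measureReal_def, Set.image_add_left, measure_preimage_add]

theorem volume_ne_top_of_subset_Ico {S : Set ℝ} {a b : ℝ} (h : S ⊆ Ico a b) : volume S ≠ ⊤ :=
  ne_top_of_le_ne_top (by simp) (measure_mono h)

theorem IsChainFamily.sum_volume_union {w u : TimedWord n} {τ : Fin k → WithBot (Fin n)}
    {S : Fin k → Set ℝ} (h : IsChainFamily w τ S) (hS : ∀ i, MeasurableSet (S i)) (i : Fin k) :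
    ∑ j, volume.real ((if j = i then Ico 0 u.len else ∅) ∪ (fun x => u.len + x) '' S j) =
      u.len + ∑ j, volume.real (S j) := by
  have : ∀ j, volume.real ((if j = i then Ico 0 u.len else ∅) ∪ (fun x => u.len + x) '' S j) =
      (if j = i then u.len else 0) + volume.real (S j) := by
    intro j
    have hfin : volume ((fun x => u.len + x) '' S j) ≠ ⊤ :=
      volume_ne_top_of_subset_Ico ((h.image_add u).subset j)
    rw [measureReal_union _ _ _ hfin, volume_real_image_add]
    · split_ifs
      · simp [u.len_nonneg]
      · simp
    · split_ifs
      · refine Set.disjoint_left.2 ?_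
        rintro _ hx ⟨x, hx', rfl⟩
        have := (h.subset j hx').1
        have := hx.2
        simp only at this
        linarith
      · exact Set.empty_disjoint _
    · rw [Set.image_add_left]
      exact measurable_const_add _ (hS j)
    · split_ifs <;> simp
  simp_rw [this]
  rw [Finset.sum_add_distrib]
  simp

theorem isIntervalUnion_union {w u : TimedWord n} {τ : Fin k → WithBot (Fin n)}
    {S : Fin k → Set ℝ} (h : IsChainFamily w τ S) (hS : ∀ i, IsIntervalUnion (S i))
    (i j : Fin k) :
    IsIntervalUnion ((if j = i then Ico 0 u.len else ∅) ∪ (fun x => u.len + x) '' S j) := by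
  split_ifs
  · refine (isIntervalUnion_Ico _ _).union ((hS j).image_add _) (Set.disjoint_left.2 ?_)
    rintro _ hx ⟨x, hx', rfl⟩
    have := (h.subset j hx').1
    have := hx.2
    simp only at this
    linarith
  · rw [Set.empty_union]
    exact (hS j).image_add _

theorem Achieves.exists_isChainFamily {E : List (Fin n × ℝ≥0)} {σ : Fin k → WithBot (Fin n)}
    {g : ℝ} (H : Achieves E σ g) : ∃ S, IsChainFamily (ofString E) σ S ∧
      (∀ i, IsIntervalUnion (S i)) ∧ g ≤ ∑ i, volume.real (S i) := by
  induction E generalizing σ g with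
  | nil =>
    refine ⟨fun _ => ∅, ⟨by simp, by simp, fun _ => Set.subsingleton_empty.monotoneOn _,
      by simp⟩, fun _ => isIntervalUnion_empty, ?_⟩
    simpa using (show g ≤ 0 from H)
  | cons p E ih =>
    rw [ofString_cons]
    rcases H with H | ⟨i, hi, H⟩
    · obtain ⟨S, hS, hI, hg⟩ := ih H
      refine ⟨_, hS.image_add _, fun i => (hI i).image_add _, hg.trans_eq ?_⟩
      simp_rw [volume_real_image_add]
    · obtain ⟨S, hS, hI, hg⟩ := ih H
      refine ⟨_, hS.union (isRow_pow p.1 p.2) i (σ := σ) (fun j => ?_) (fun x h0 h1 => ?_)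
        (fun x h0 h1 y hy => ?_), isIntervalUnion_union hS hI i, ?_⟩
      · by_cases hj : j = i
        · subst hj; simpa using hi
        · simp [hj]
      · rwa [toFun_pow h0 h1]
      · rw [toFun_pow h0 h1]
        simpa using hS.level i y hy
      · rw [hS.sum_volume_union fun i => (hI i).measurableSet]
        rw [len_pow]
        linarith

/-- All chains together get at most `t` from the first block `c^t`, so nothing is lost if one chain
that meets it takes all of it. By monotonicity the later letters of that chain are `≥ c`; the other
chains keep their levels. -/
theorem IsChainFamily.achieves {E : List (Fin n × ℝ≥0)} {σ : Fin k → WithBot (Fin n)}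
    {S : Fin k → Set ℝ} (h : IsChainFamily (ofString E) σ S) (hS : ∀ i, MeasurableSet (S i)) :
    Achieves E σ (∑ i, volume.real (S i)) := by
  induction E generalizing σ S with
  | nil =>
    refine (Finset.sum_eq_zero fun i _ => ?_).le
    have : S i = ∅ := Set.eq_empty_of_subset_empty ((h.subset i).trans (by simp))
    simp [this]
  | cons p E ih =>
    obtain ⟨c, t⟩ := p
    rw [ofString_cons] at h
    set w := ofString E with hw
    simp only at h
    -- The parts of the chains beyond the first block, translated back to the word `w`.
    let T : Fin k → Set ℝ := fun i => Ici 0 ∩ (fun x => (t : ℝ) + x) ⁻¹' S i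
    have hT : ∀ i, MeasurableSet (T i) := fun i =>
      measurableSet_Ici.inter (measurable_const_add _ (hS i))
    have hwT : ∀ i, ∀ x ∈ T i, (pow c t * w).toFun (t + x) = w.toFun x := fun i x hx =>
      toFun_mul_add (pow c t) w hx.1
    have hsplit : ∀ i, volume.real (S i) = volume.real (S i ∩ Ico 0 (t : ℝ)) +
        volume.real (T i) := by
      intro i
      have himg : (fun x => (t : ℝ) + x) '' T i = S i \ Ico 0 (t : ℝ) := by
        ext x
        constructor
        · rintro ⟨x, hx, rfl⟩
          exact ⟨hx.2, fun h => by have := h.2; have := hx.1; simp only [mem_Ici] at *; linarith⟩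
        · rintro ⟨hx, hx'⟩
          have h0 := (h.subset i hx).1
          have : (t : ℝ) ≤ x := not_lt.1 fun h1 => hx' ⟨h0, h1⟩
          exact ⟨x - t, ⟨by simp only [mem_Ici]; linarith, by simpa using hx⟩, by simp⟩
      rw [← volume_real_image_add t (T i), himg]
      exact (measureReal_inter_add_sdiff measurableSet_Ico
        (volume_ne_top_of_subset_Ico (h.subset i))).symm
    have hTfam : ∀ τ : Fin k → WithBot (Fin n), (∀ i, ∀ x ∈ T i, τ i ≤ w.toFun x) →
        IsChainFamily w τ T := by
      intro τ hτ
      refine ⟨fun i x hx => ⟨hx.1, ?_⟩, fun i j hij => ?_, fun i x hx y hy hxy => ?_, hτ⟩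
      · have := (h.subset i hx.2).2
        simpa using this
      · exact ((h.disjoint i j hij).preimage _).mono Set.inter_subset_right Set.inter_subset_right
      · rw [← hwT i x hx, ← hwT i y hy]
        exact h.monotoneOn i hx.2 hy.2 (by linarith)
    have hσT : ∀ i, ∀ x ∈ T i, σ i ≤ w.toFun x := fun i x hx => by
      rw [← hwT i x hx]; exact h.level i _ hx.2
    by_cases hne : ∃ i, (S i ∩ Ico 0 (t : ℝ)).Nonempty
    · obtain ⟨i, z, hz, hz0⟩ := hne
      have hzc : (pow c t * w).toFun z = c := by
        rw [toFun_mul_of_lt _ _ (by simpa using hz0.2), toFun_pow hz0.1 hz0.2]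
      refine Achieves.take i (by simpa [hzc] using h.level i z hz)
        ((ih (σ := Function.update σ i c) (hTfam _ fun j x hx => ?_) hT).mono le_rfl ?_)
      · by_cases hj : j = i
        · subst hj
          rw [Function.update_self, ← hwT j x hx, ← hzc]
          refine h.monotoneOn j hz hx.2 ?_
          have h1 := hz0.2
          have h2 : 0 ≤ x := hx.1
          linarith
        · rw [Function.update_of_ne hj]
          exact hσT j x hx
      · simp_rw [hsplit]
        rw [Finset.sum_add_distrib]
        have : ∑ i, volume.real (S i ∩ Ico 0 (t : ℝ)) ≤ t := by
          rw [← measureReal_biUnion_finset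
            (fun i _ j _ hij => (h.disjoint i j hij).mono Set.inter_subset_left
              Set.inter_subset_left)
            (fun i _ => (hS i).inter measurableSet_Ico)
            (fun i _ => volume_ne_top_of_subset_Ico Set.inter_subset_right)]
          refine (measureReal_mono (s₂ := Ico 0 (t : ℝ)) ?_ (by simp)).trans (by simp)
          exact Set.iUnion₂_subset fun i _ => Set.inter_subset_right
        linarith
    · refine ((ih (hTfam σ hσT) hT).mono le_rfl ?_).skip
      refine Finset.sum_le_sum fun i _ => ?_
      rw [hsplit, Set.not_nonempty_iff_eq_empty.1 fun h => hne ⟨i, h⟩]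
      simp

end ChainFamily

/-! ### Timed subwords `w_S` and monotonicity on `S`. -/

section Subword

theorem volume_Ico_inter_mono (S : Set ℝ) {x y : ℝ} (h : x ≤ y) :
    volume.real (Ico 0 x ∩ S) ≤ volume.real (Ico 0 y ∩ S) :=
  measureReal_mono (Set.inter_subset_inter_left _ (Set.Ico_subset_Ico_right h))
    (volume_ne_top_of_subset_Ico Set.inter_subset_left)

theorem volume_Ico_inter_add {S : Set ℝ} {x y : ℝ} (h0 : 0 ≤ x) (h : x ≤ y) :
    volume.real (Ico 0 y ∩ S) = volume.real (Ico 0 x ∩ S) + volume.real (Ico x y ∩ S) := by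
  have h1 : (Ico 0 y ∩ S) ∩ Ico 0 x = Ico 0 x ∩ S := by
    ext z
    simp only [mem_inter_iff, mem_Ico]
    constructor
    · rintro ⟨⟨_, h1⟩, h2⟩; exact ⟨h2, h1⟩
    · rintro ⟨h2, h1⟩; exact ⟨⟨⟨h2.1, h2.2.trans_le h⟩, h1⟩, h2⟩
  have h2 : (Ico 0 y ∩ S) \ Ico 0 x = Ico x y ∩ S := by
    ext z
    simp only [mem_inter_iff, mem_Ico, mem_sdiff, not_and, not_lt]
    constructor
    · rintro ⟨⟨h1, h3⟩, h2⟩; exact ⟨⟨h2 h1.1, h1.2⟩, h3⟩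
    · rintro ⟨h2, h1⟩; exact ⟨⟨⟨h0.trans h2.1, h2.2⟩, h1⟩, fun _ => h2.1⟩
  rw [← measureReal_inter_add_sdiff (s := Ico 0 y ∩ S) measurableSet_Ico
    (volume_ne_top_of_subset_Ico Set.inter_subset_left), h1, h2]

/-- This continuity of `x ↦ meas([0, x) ∩ S)` lets an endpoint be moved back a little without losing
a strict inequality. -/
theorem volume_Ico_inter_lipschitz (S : Set ℝ) {x y : ℝ} (h0 : 0 ≤ x) (h : x ≤ y) :
    volume.real (Ico 0 y ∩ S) ≤ volume.real (Ico 0 x ∩ S) + (y - x) := by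
  rw [volume_Ico_inter_add h0 h]
  have : volume.real (Ico x y ∩ S) ≤ volume.real (Ico x y) :=
    measureReal_mono Set.inter_subset_left (by simp)
  rw [Real.volume_real_Ico_of_le h] at this
  linarith

variable {w : TimedWord n} {S : Set ℝ}

/-- The position in `w` of the point at time `t` of the subword `w_S`. -/
noncomputable def subwordPos (w : TimedWord n) (S : Set ℝ) (t : ℝ) : ℝ :=
  sInf {x : ℝ | x ∈ Ico 0 w.len ∧ t < volume.real (Ico 0 x ∩ S)}

theorem subwordPos_nonempty (hS : S ⊆ Ico 0 w.len) {t : ℝ} (h0 : 0 ≤ t)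
    (h1 : t < volume.real S) :
    {x : ℝ | x ∈ Ico 0 w.len ∧ t < volume.real (Ico 0 x ∩ S)}.Nonempty := by
  have hS' : Ico 0 w.len ∩ S = S := Set.inter_eq_right.2 hS
  have hl : 0 < w.len := by
    by_contra h
    have hemp : S = ∅ := Set.eq_empty_of_subset_empty (hS.trans (by simp [not_lt.1 h]))
    rw [hemp] at h1
    simp at h1
    linarith
  -- Half of the slack: stopping `d` before the end of `w` costs at most `d` in measure.
  -- Nonemptiness matters since `sInf ∅` would be the default value `0`.
  set d := (volume.real S - t) / 2
  have hd : 0 < d := by simp only [d]; linarith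
  refine ⟨max 0 (w.len - d), ⟨le_max_left _ _, max_lt hl (by linarith)⟩, ?_⟩
  have := volume_Ico_inter_lipschitz S (le_max_left 0 (w.len - d))
    (max_le hl.le (by linarith : w.len - d ≤ w.len))
  rw [hS'] at this
  have h2 := le_max_right 0 (w.len - d)
  simp only [d] at *
  linarith

theorem subwordPos_bddBelow (w : TimedWord n) (S : Set ℝ) (t : ℝ) :
    BddBelow {x : ℝ | x ∈ Ico 0 w.len ∧ t < volume.real (Ico 0 x ∩ S)} :=
  ⟨0, fun _ hx => hx.1.1⟩

theorem subwordPos_mem_Ico (hS : S ⊆ Ico 0 w.len) {t : ℝ} (h0 : 0 ≤ t)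
    (h1 : t < volume.real S) : subwordPos w S t ∈ Ico 0 w.len := by
  obtain ⟨x, hx⟩ := subwordPos_nonempty hS h0 h1
  exact ⟨le_csInf ⟨x, hx⟩ fun y hy => hy.1.1,
    (csInf_le (subwordPos_bddBelow w S t) hx).trans_lt hx.1.2⟩

theorem lt_volume_of_subwordPos_lt (hS : S ⊆ Ico 0 w.len) {t x : ℝ} (h0 : 0 ≤ t)
    (h1 : t < volume.real S) (hx : subwordPos w S t < x) : t < volume.real (Ico 0 x ∩ S) := by
  obtain ⟨y, hy, hyx⟩ := exists_lt_of_csInf_lt (subwordPos_nonempty hS h0 h1) hx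
  exact hy.2.trans_le (volume_Ico_inter_mono S hyx.le)

theorem volume_le_of_le_subwordPos {t x : ℝ} (hS : S ⊆ Ico 0 w.len) (h0 : 0 ≤ t)
    (h1 : t < volume.real S) (hx : x ≤ subwordPos w S t) :
    volume.real (Ico 0 x ∩ S) ≤ t := by
  by_contra! hlt
  have hx0 : 0 < x := by
    by_contra h
    rw [Set.Ico_eq_empty h] at hlt
    simp at hlt
    linarith
  set d := (volume.real (Ico 0 x ∩ S) - t) / 2
  have hd : 0 < d := by simp only [d]; linarith
  have hz : max 0 (x - d) < x := max_lt hx0 (by linarith)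
  have := volume_Ico_inter_lipschitz S (le_max_left 0 (x - d)) hz.le
  have h2 := le_max_right 0 (x - d)
  have hmem := subwordPos_mem_Ico hS h0 h1
  refine absurd (csInf_le (subwordPos_bddBelow w S t) (a := max 0 (x - d))
    ⟨⟨le_max_left _ _, hz.trans_le (hx.trans hmem.2.le)⟩, ?_⟩) (not_le.2 (hz.trans_le hx))
  simp only [d] at *
  linarith

theorem subwordPos_mono (hS : S ⊆ Ico 0 w.len) {s t : ℝ} (h0 : 0 ≤ s) (hst : s ≤ t)
    (h1 : t < volume.real S) : subwordPos w S s ≤ subwordPos w S t :=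
  csInf_le_csInf (subwordPos_bddBelow w S s) (subwordPos_nonempty hS (h0.trans hst) h1)
    fun _ hx => ⟨hx.1, hst.trans_lt hx.2⟩

/-- To the right of a point outside `S` the measure would be constant for a while, so the infimum
would lie further to the right. -/
theorem subwordPos_mem (hI : IsIntervalUnion S) (hS : S ⊆ Ico 0 w.len) {t : ℝ} (h0 : 0 ≤ t)
    (h1 : t < volume.real S) : subwordPos w S t ∈ S := by
  by_contra h
  obtain ⟨y, hy, hd⟩ := hI.exists_Ico_disjoint h
  have h2 := lt_volume_of_subwordPos_lt hS h0 h1 hy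
  rw [volume_Ico_inter_add (subwordPos_mem_Ico hS h0 h1).1 hy.le,
    Set.disjoint_iff_inter_eq_empty.1 hd, measureReal_empty, add_zero] at h2
  exact absurd (volume_le_of_le_subwordPos hS h0 h1 le_rfl) (not_le.2 h2)

theorem volume_Ico_inter_lt (hI : IsIntervalUnion S) {x y : ℝ} (h0 : 0 ≤ x) (hx : x ∈ S)
    (hxy : x < y) : volume.real (Ico 0 x ∩ S) < volume.real (Ico 0 y ∩ S) := by
  obtain ⟨z, hz, hsub⟩ := hI.exists_Ico_subset hx
  rw [volume_Ico_inter_add h0 hxy.le]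
  have h1 : Ico x (min y z) ⊆ Ico x y ∩ S := fun v hv =>
    ⟨⟨hv.1, hv.2.trans_le (min_le_left _ _)⟩, hsub ⟨hv.1, hv.2.trans_le (min_le_right _ _)⟩⟩
  have h2 := measureReal_mono (μ := volume) h1 (volume_ne_top_of_subset_Ico Set.inter_subset_left)
  have h3 : x < min y z := lt_min hxy hz
  rw [Real.volume_real_Ico_of_le h3.le] at h2
  linarith

theorem volume_Ico_inter_lt_volume (hI : IsIntervalUnion S) (hS : S ⊆ Ico 0 w.len) {x : ℝ}
    (hx : x ∈ S) : volume.real (Ico 0 x ∩ S) < volume.real S := by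
  have := volume_Ico_inter_lt hI (hS hx).1 hx (hS hx).2
  rwa [Set.inter_eq_right.2 hS] at this

theorem subwordPos_volume (hI : IsIntervalUnion S) (hS : S ⊆ Ico 0 w.len) {x : ℝ}
    (hx : x ∈ S) : subwordPos w S (volume.real (Ico 0 x ∩ S)) = x := by
  have h0 : 0 ≤ volume.real (Ico 0 x ∩ S) := measureReal_nonneg
  have h1 := volume_Ico_inter_lt_volume hI hS hx
  refine le_antisymm ?_ ?_
  · by_contra! h
    exact absurd (volume_le_of_le_subwordPos hS h0 h1 le_rfl)
      (not_le.2 (volume_Ico_inter_lt hI (hS hx).1 hx h))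
  · by_contra! h
    exact absurd (lt_volume_of_subwordPos_lt hS h0 h1 h) (lt_irrefl _)

open Classical in
/-- The timed subword `w_S`. -/
noncomputable def subword (w : TimedWord n) (S : Set ℝ) (hS : S ⊆ Ico 0 w.len) : TimedWord n where
  len := volume.real S
  toFun t := if 0 ≤ t ∧ t < volume.real S then w.toFun (subwordPos w S t) else ⊥
  len_nonneg := measureReal_nonneg
  toFun_ne_bot_iff t := by
    split_ifs with h
    · simp only [h, and_self, iff_true]
      exact (w.toFun_ne_bot_iff _).2 (subwordPos_mem_Ico hS h.1 h.2)
    · simp [h]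
  finite_breaks := by
    obtain ⟨D, hD⟩ := w.finite_breaks
    -- A break `d` of `w` shows up at time `meas([0, d) ∩ S)`: if `d` separates the positions of `x`
    -- and `y`, this time separates `x` and `y`.
    refine ⟨D.image fun d => volume.real (Ico 0 d ∩ S), fun x y hx hxy hy h => ?_⟩
    have hx' := hxy.trans_lt hy
    have hy' := hx.trans hxy
    rw [if_pos ⟨hx, hx'⟩, if_pos ⟨hy', hy⟩]
    refine hD _ _ (subwordPos_mem_Ico hS hx hx').1 (subwordPos_mono hS hx hxy hy)
      (subwordPos_mem_Ico hS hy' hy).2 fun d hd hc => ?_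
    exact h _ (Finset.mem_image_of_mem _ hd) ⟨lt_volume_of_subwordPos_lt hS hx hx' hc.1,
      volume_le_of_le_subwordPos hS hy' hy hc.2⟩

theorem isSubwordAt_subword (hI : IsIntervalUnion S) (hS : S ⊆ Ico 0 w.len) :
    (w.subword S hS).IsSubwordAt w S :=
  ⟨hI, hS, rfl, fun _ h0 h1 => if_pos ⟨h0, h1⟩⟩

/-- The subword `w_S` is a row if and only if `w` is weakly increasing on `S`. -/
theorem IsSubwordAt.isRow_iff {u : TimedWord n} (h : u.IsSubwordAt w S) :
    u.IsRow ↔ MonotoneOn w.toFun S := by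
  obtain ⟨hI, hS, hlen, hu⟩ := h
  constructor
  · intro hr x hx y hy hxy
    have := hr _ _ measureReal_nonneg (volume_Ico_inter_mono S hxy)
      (hlen ▸ volume_Ico_inter_lt_volume hI hS hy)
    rw [hu _ measureReal_nonneg (volume_Ico_inter_lt_volume hI hS hx),
      hu _ measureReal_nonneg (volume_Ico_inter_lt_volume hI hS hy)] at this
    change w.toFun (subwordPos w S _) ≤ w.toFun (subwordPos w S _) at this
    rwa [subwordPos_volume hI hS hx, subwordPos_volume hI hS hy] at this
  · intro hm x y hx hxy hy
    rw [hlen] at hy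
    rw [hu x hx (hxy.trans_lt hy), hu y (hx.trans hxy) hy]
    exact hm (subwordPos_mem hI hS hx (hxy.trans_lt hy))
      (subwordPos_mem hI hS (hx.trans hxy) hy) (subwordPos_mono hS hx hxy hy)

/-- Subwords disappear from the problem by `IsSubwordAt.isRow_iff`; the level `⊥` imposes no
condition. -/
theorem mem_rowSubwordLengths_iff {k : ℕ} {s : ℝ} : s ∈ w.rowSubwordLengths k ↔
    ∃ S : Fin k → Set ℝ, IsChainFamily w (fun _ => ⊥) S ∧ (∀ i, IsIntervalUnion (S i)) ∧
      s = ∑ i, volume.real (S i) := by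
  constructor
  · rintro ⟨u, S, hu, hS, hr, rfl⟩
    exact ⟨S, ⟨fun i => (hu i).2.1, hS, fun i => (hu i).isRow_iff.1 (hr i), by simp⟩,
      fun i => (hu i).1, Finset.sum_congr rfl fun i _ => (hu i).2.2.1⟩
  · rintro ⟨S, hS, hI, rfl⟩
    have h := fun i => isSubwordAt_subword (hI i) (hS.subset i)
    exact ⟨_, S, h, hS.disjoint, fun i => (h i).isRow_iff.2 (hS.monotoneOn i), rfl⟩

end Subword

/-! ### Greene equivalence as a congruence, and the Knuth relations for it. -/

section Equivalence

/-- `w` has `k` pairwise disjoint increasing subwords of total length at least `g`. -/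
def GreeneAchieves (k : ℕ) (w : TimedWord n) (g : ℝ) : Prop :=
  ∃ S : Fin k → Set ℝ, IsChainFamily w (fun _ => ⊥) S ∧ (∀ i, IsIntervalUnion (S i)) ∧
    g ≤ ∑ i, volume.real (S i)

theorem greeneAchieves_iff {k : ℕ} {w : TimedWord n} {g : ℝ} :
    GreeneAchieves k w g ↔ ∃ s ∈ w.rowSubwordLengths k, g ≤ s := by
  constructor
  · rintro ⟨S, h1, h2, h3⟩
    exact ⟨_, mem_rowSubwordLengths_iff.2 ⟨S, h1, h2, rfl⟩, h3⟩
  · rintro ⟨s, hs, hg⟩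
    obtain ⟨S, h1, h2, rfl⟩ := mem_rowSubwordLengths_iff.1 hs
    exact ⟨S, h1, h2, hg⟩

theorem greeneAchieves_ofString_iff {k : ℕ} {E : List (Fin n × ℝ≥0)} {g : ℝ} :
    GreeneAchieves k (ofString E) g ↔ Achieves E (fun _ : Fin k => ⊥) g := by
  constructor
  · rintro ⟨S, h1, h2, h3⟩
    exact (h1.achieves fun i => (h2 i).measurableSet).mono le_rfl h3
  · exact fun h => h.exists_isChainFamily

/-- Two words are Greene equivalent if they have the same Greene invariants in every context. -/
def GreeneEquiv (u v : TimedWord n) : Prop :=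
  ∀ x y k g, GreeneAchieves k (x * u * y) g ↔ GreeneAchieves k (x * v * y) g

namespace GreeneEquiv

theorem refl (u : TimedWord n) : GreeneEquiv u u := fun _ _ _ _ => Iff.rfl

theorem trans {u v w : TimedWord n} (h : GreeneEquiv u v) (h' : GreeneEquiv v w) :
    GreeneEquiv u w :=
  fun x y k g => (h x y k g).trans (h' x y k g)

theorem mul_left (x : TimedWord n) {u v : TimedWord n} (h : GreeneEquiv u v) :
    GreeneEquiv (x * u) (x * v) := fun z y k g => by
  simpa only [mul_assoc] using h (z * x) y k g

theorem mul_right {u v : TimedWord n} (h : GreeneEquiv u v) (y : TimedWord n) :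
    GreeneEquiv (u * y) (v * y) := fun x z k g => by
  simpa only [mul_assoc] using h x (y * z) k g

/-- The right context is the continuation `Y`. A left context leads to arbitrary levels, whence the
quantification over `σ`, although the Greene invariants themselves start from `⊥`. -/
theorem of_achieves {E F : List (Fin n × ℝ≥0)}
    (h : ∀ Y k (σ : Fin k → WithBot (Fin n)) g, Achieves (E ++ Y) σ g ↔ Achieves (F ++ Y) σ g) :
    GreeneEquiv (ofString E) (ofString F) := fun x y k g => by
  obtain ⟨X, rfl⟩ := x.exists_ofString
  obtain ⟨Y, rfl⟩ := y.exists_ofString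
  simp only [← ofString_append, greeneAchieves_ofString_iff, List.append_assoc]
  exact Achieves.append_congr (h Y k) X _ g

theorem knuth_right {b c : Fin n} (hcb : c < b) (t : ℝ≥0) {F : List (Fin n × ℝ≥0)}
    (hF : ∀ p ∈ F, b ≤ p.1) (hs : F.Pairwise fun p q => p.1 ≤ q.1) :
    GreeneEquiv (pow b t * ofString F * pow c t) (pow b t * pow c t * ofString F) := by
  have := of_achieves (E := (b, t) :: (F ++ [(c, t)])) (F := (b, t) :: (c, t) :: F)
    fun Y k σ g => by simpa using achieves_knuth_right hcb t hF hs Y σ g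
  simpa [mul_assoc] using this

theorem knuth_left {b c : Fin n} (hcb : c < b) (t : ℝ≥0) {F : List (Fin n × ℝ≥0)}
    (hF : ∀ p ∈ F, p.1 ≤ c) (hs : F.Pairwise fun p q => p.1 ≤ q.1) :
    GreeneEquiv (ofString F * pow b t * pow c t) (pow b t * ofString F * pow c t) := by
  have := of_achieves (E := F ++ [(b, t), (c, t)]) (F := (b, t) :: (F ++ [(c, t)]))
    fun Y k σ g => by simpa using achieves_knuth_left hcb t hF hs Y σ g
  simpa [mul_assoc] using this

end GreeneEquiv
end Equivalence

/-! ### Letters of words, and rows as products. -/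

section Letters

/-- The letters that occur in `w`. -/
def letters (w : TimedWord n) : Set (Fin n) := {c | ∃ x, w.toFun x = c}

theorem mem_letters_of_toFun_eq {w : TimedWord n} {x : ℝ} {c : Fin n} (h : w.toFun x = c) :
    c ∈ w.letters := ⟨x, h⟩

theorem mem_range_of_toFun_eq {w : TimedWord n} {x : ℝ} {c : Fin n} (h : w.toFun x = c) :
    0 ≤ x ∧ x < w.len :=
  (w.toFun_ne_bot_iff x).1 (h ▸ WithBot.coe_ne_bot)

theorem exists_toFun_eq {w : TimedWord n} {x : ℝ} (h0 : 0 ≤ x) (h1 : x < w.len) :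
    ∃ c : Fin n, w.toFun x = c := by
  obtain ⟨c, hc⟩ := WithBot.ne_bot_iff_exists.1 ((w.toFun_ne_bot_iff x).2 ⟨h0, h1⟩)
  exact ⟨c, hc.symm⟩

@[simp] theorem letters_one : (1 : TimedWord n).letters = ∅ := by
  ext c
  simp [letters]

@[simp] theorem letters_mul (u v : TimedWord n) : (u * v).letters = u.letters ∪ v.letters := by
  ext c
  constructor
  · rintro ⟨x, hx⟩
    by_cases h : x < u.len
    · exact Or.inl ⟨x, by rwa [toFun_mul_of_lt _ _ h] at hx⟩
    · exact Or.inr ⟨_, by rwa [toFun_mul_of_le _ _ (not_lt.1 h)] at hx⟩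
  · rintro (⟨x, hx⟩ | ⟨x, hx⟩)
    · exact ⟨x, by rwa [toFun_mul_of_lt _ _ (mem_range_of_toFun_eq hx).2]⟩
    · exact ⟨u.len + x, by rwa [toFun_mul_add _ _ (mem_range_of_toFun_eq hx).1]⟩

theorem eq_of_mem_letters_pow {c d : Fin n} {t : ℝ≥0} (h : d ∈ (pow c t).letters) : d = c := by
  obtain ⟨x, hx⟩ := h
  obtain ⟨h0, h1⟩ := mem_range_of_toFun_eq hx
  rw [toFun_pow h0 h1] at hx
  exact (WithBot.coe_injective hx).symm

theorem mem_letters_pow (c : Fin n) {t : ℝ≥0} (h : 0 < t) : c ∈ (pow c t).letters :=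
  ⟨0, toFun_pow le_rfl h⟩

theorem mem_letters_ofString {E : List (Fin n × ℝ≥0)} (hE : ∀ p ∈ E, 0 < p.2)
    {p : Fin n × ℝ≥0} (hp : p ∈ E) : p.1 ∈ (ofString E).letters := by
  induction E with
  | nil => simp at hp
  | cons q E ih =>
    rw [ofString_cons, letters_mul]
    rcases List.mem_cons.1 hp with rfl | hp
    · exact Or.inl (mem_letters_pow _ (hE p List.mem_cons_self))
    · exact Or.inr (ih (fun r hr => hE r (List.mem_cons_of_mem _ hr)) hp)

theorem exists_of_mem_letters_ofString {E : List (Fin n × ℝ≥0)} {c : Fin n}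
    (h : c ∈ (ofString E).letters) : ∃ p ∈ E, p.1 = c := by
  induction E with
  | nil => simp at h
  | cons q E ih =>
    rw [ofString_cons, letters_mul] at h
    rcases h with h | h
    · exact ⟨q, List.mem_cons_self, (eq_of_mem_letters_pow h).symm⟩
    · obtain ⟨p, hp, hc⟩ := ih h
      exact ⟨p, List.mem_cons_of_mem _ hp, hc⟩

theorem isRow_one : (1 : TimedWord n).IsRow := fun x y hx hxy hy => by
  rw [len_one] at hy; linarith

theorem isRow_mul_iff {u v : TimedWord n} : (u * v).IsRow ↔
    u.IsRow ∧ v.IsRow ∧ ∀ c ∈ u.letters, ∀ d ∈ v.letters, c ≤ d := by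
  constructor
  · refine fun h => ⟨fun x y hx hxy hy => ?_, h.right, ?_⟩
    · have := h x y hx hxy (by rw [len_mul]; linarith [v.len_nonneg])
      rwa [toFun_mul_of_lt _ _ hy, toFun_mul_of_lt _ _ (hxy.trans_lt hy)] at this
    · rintro c ⟨x, hx⟩ d ⟨y, hy⟩
      obtain ⟨hx0, hx1⟩ := mem_range_of_toFun_eq hx
      obtain ⟨hy0, hy1⟩ := mem_range_of_toFun_eq hy
      have := h x (u.len + y) hx0 (by linarith) (by rw [len_mul]; linarith)
      rwa [toFun_mul_of_lt _ _ hx1, toFun_mul_add _ _ hy0, hx, hy, WithBot.coe_le_coe] at this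
  · rintro ⟨hu, hv, huv⟩ x y hx hxy hy
    rw [len_mul] at hy
    by_cases h1 : y < u.len
    · rw [toFun_mul_of_lt _ _ h1, toFun_mul_of_lt _ _ (hxy.trans_lt h1)]
      exact hu x y hx hxy h1
    · rw [toFun_mul_of_le _ _ (not_lt.1 h1)]
      by_cases h2 : x < u.len
      · rw [toFun_mul_of_lt _ _ h2]
        obtain ⟨c, hc⟩ := exists_toFun_eq hx h2
        obtain ⟨d, hd⟩ := exists_toFun_eq (w := v) (x := y - u.len) (by linarith) (by linarith)
        rw [hc, hd, WithBot.coe_le_coe]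
        exact huv c ⟨x, hc⟩ d ⟨_, hd⟩
      · rw [toFun_mul_of_le _ _ (not_lt.1 h2)]
        exact hv _ _ (by linarith) (by linarith) (by linarith)

theorem isRow_ofString_of_pairwise {E : List (Fin n × ℝ≥0)}
    (h : E.Pairwise fun p q => p.1 ≤ q.1) : (ofString E).IsRow := by
  induction E with
  | nil => exact isRow_one
  | cons p E ih =>
    rw [List.pairwise_cons] at h
    rw [ofString_cons, isRow_mul_iff]
    refine ⟨isRow_pow _ _, ih h.2, fun c hc d hd => ?_⟩
    obtain ⟨q, hq, rfl⟩ := exists_of_mem_letters_ofString hd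
    rw [eq_of_mem_letters_pow hc]
    exact h.1 q hq

theorem IsRow.pairwise {E : List (Fin n × ℝ≥0)} (h : (ofString E).IsRow)
    (hE : ∀ p ∈ E, 0 < p.2) : E.Pairwise fun p q => p.1 ≤ q.1 := by
  induction E with
  | nil => exact List.Pairwise.nil
  | cons p E ih =>
    rw [ofString_cons, isRow_mul_iff] at h
    have hE' : ∀ q ∈ E, 0 < q.2 := fun q hq => hE q (List.mem_cons_of_mem _ hq)
    exact List.pairwise_cons.2 ⟨fun q hq => h.2.2 _ (mem_letters_pow _ (hE p List.mem_cons_self))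
      _ (mem_letters_ofString hE' hq), ih h.2.1 hE'⟩

/-- A lower set of letters occupies an initial segment of a row. This cut gives the place of bumping
as well as the meaning of `cum` for rows. -/
theorem IsRow.exists_split {u : TimedWord n} (h : u.IsRow) (P : Fin n → Prop)
    (hP : ∀ c d, c ≤ d → P d → P c) : ∃ A Z, u = A * Z ∧ A.IsRow ∧ Z.IsRow ∧
      (∀ c ∈ A.letters, P c) ∧ ∀ c ∈ Z.letters, ¬ P c := by
  obtain ⟨E, hE, rfl⟩ := u.exists_expString
  change (ofString E).IsRow at h
  change ∃ A Z, ofString E = A * Z ∧ _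
  induction E with
  | nil => exact ⟨1, 1, by simp, isRow_one, isRow_one, by simp, by simp⟩
  | cons p E ih =>
    rw [ofString_cons] at h ⊢
    obtain ⟨h1, h2, h3⟩ := isRow_mul_iff.1 h
    obtain ⟨A, Z, hAZ, hA, hZ, hA', hZ'⟩ := ih (fun q hq => hE q (List.mem_cons_of_mem _ hq)) h2
    by_cases hp : P p.1
    · refine ⟨pow p.1 p.2 * A, Z, by rw [hAZ, mul_assoc], ?_, hZ, ?_, hZ'⟩
      · exact isRow_mul_iff.2 ⟨h1, hA, fun c hc d hd => h3 c hc d (by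
          rw [hAZ, letters_mul]; exact Or.inl hd)⟩
      · rw [letters_mul]
        rintro c (hc | hc)
        · rwa [eq_of_mem_letters_pow hc]
        · exact hA' c hc
    · refine ⟨1, pow p.1 p.2 * ofString E, by simp, isRow_one, h, by simp, ?_⟩
      rw [letters_mul]
      rintro c (hc | hc)
      · rwa [eq_of_mem_letters_pow hc]
      · exact fun hPc => hp (hP _ _ (h3 _ (mem_letters_pow _ (hE p List.mem_cons_self)) c hc) hPc)

theorem pow_add (c : Fin n) (s t : ℝ≥0) : pow c (s + t) = pow c s * pow c t := by
  apply ext_toFun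
  funext x
  by_cases h0 : 0 ≤ x ∧ x < (s + t : ℝ≥0)
  · rw [toFun_pow h0.1 h0.2]
    have h1 := h0.2
    rw [NNReal.coe_add] at h1
    by_cases hs : x < s
    · rw [toFun_mul_of_lt _ _ (by simpa using hs), toFun_pow h0.1 hs]
    · rw [toFun_mul_of_le _ _ (by simpa using hs), len_pow, toFun_pow (by linarith) (by linarith)]
  · rw [toFun_eq_bot _ (by simpa using h0), toFun_eq_bot _ (by simpa using h0)]

theorem pow_zero (c : Fin n) : pow c 0 = 1 := eq_one_of_len _ (by simp)

end Letters

/-! ### Weights, their partial sums, and domination of rows. -/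

section Weight

theorem measurableSet_toFun_eq (w : TimedWord n) (c : Fin n) :
    MeasurableSet {x | w.toFun x = (c : WithBot (Fin n))} := by
  obtain ⟨E, rfl⟩ := w.exists_ofString
  induction E with
  | nil => simp
  | cons p E ih =>
    have : {x | (ofString (p :: E)).toFun x = (c : WithBot (Fin n))} =
        (Ico 0 (p.2 : ℝ) ∩ {_x | p.1 = c}) ∪
          (fun x => x - p.2) ⁻¹' {x | (ofString E).toFun x = (c : WithBot (Fin n))} := by
      ext x
      simp only [ofString_cons, mem_union, mem_inter_iff, mem_ofPred_eq, mem_preimage]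
      by_cases hx : x < p.2
      · rw [toFun_mul_of_lt _ _ (by simpa using hx)]
        have h2 : (ofString E).toFun (x - p.2) ≠ (c : WithBot (Fin n)) := fun h => by
          linarith [(mem_range_of_toFun_eq h).1]
        by_cases h0 : 0 ≤ x
        · rw [toFun_pow h0 hx]
          simp [h0, hx, h2]
        · rw [toFun_eq_bot _ fun h => h0 h.1]
          simp [h0, h2]
      · rw [toFun_mul_of_le _ _ (by simpa using hx)]
        simp [hx]
    rw [this]
    exact (measurableSet_Ico.inter (MeasurableSet.const _)).union (measurable_sub_const _ ih)

theorem toFun_eq_subset (w : TimedWord n) (c : Fin n) :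
    {x | w.toFun x = (c : WithBot (Fin n))} ⊆ Ico 0 w.len :=
  fun _ hx => mem_range_of_toFun_eq hx

theorem coe_wt (w : TimedWord n) (c : Fin n) :
    (w.wt c : ℝ) = volume.real {x | w.toFun x = (c : WithBot (Fin n))} := rfl

@[simp] theorem wt_one (c : Fin n) : (1 : TimedWord n).wt c = 0 := by simp [wt]

theorem wt_mul (u v : TimedWord n) (c : Fin n) : (u * v).wt c = u.wt c + v.wt c := by
  rw [← NNReal.coe_inj, NNReal.coe_add, coe_wt, coe_wt, coe_wt, ← volume_real_image_add u.len
    {x | v.toFun x = c}]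
  have h2 : (fun x => u.len + x) '' {x | v.toFun x = (c : WithBot (Fin n))} ⊆
      Ico u.len (u.len + v.len) := by
    rintro _ ⟨x, hx, rfl⟩
    have := toFun_eq_subset v c hx
    exact ⟨by simp only; linarith [this.1], by simp only; linarith [this.2]⟩
  rw [← measureReal_union _ _ (volume_ne_top_of_subset_Ico (toFun_eq_subset u c))
    (volume_ne_top_of_subset_Ico h2)]
  · congr 1
    ext x
    simp only [mem_ofPred_eq, mem_union, mem_image]
    constructor
    · intro hx
      by_cases h : x < u.len
      · exact Or.inl (by rwa [toFun_mul_of_lt _ _ h] at hx)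
      · refine Or.inr ⟨x - u.len, by rwa [toFun_mul_of_le _ _ (not_lt.1 h)] at hx, by ring⟩
    · rintro (hx | ⟨x, hx, rfl⟩)
      · rwa [toFun_mul_of_lt _ _ (mem_range_of_toFun_eq hx).2]
      · rwa [toFun_mul_add _ _ (mem_range_of_toFun_eq hx).1]
  · exact Set.disjoint_left.2 fun x hx hx' =>
      absurd (toFun_eq_subset u c hx).2 (not_lt.2 (h2 hx').1)
  · rw [Set.image_add_left]
    exact measurable_const_add _ (measurableSet_toFun_eq v c)

theorem wt_pow (c d : Fin n) (t : ℝ≥0) : (pow c t).wt d = if c = d then t else 0 := by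
  rw [← NNReal.coe_inj, coe_wt]
  split_ifs with h
  · subst h
    have : {x | (pow c t).toFun x = (c : WithBot (Fin n))} = Ico 0 (t : ℝ) := by
      ext x
      exact ⟨fun hx => toFun_eq_subset _ _ hx, fun hx => toFun_pow hx.1 hx.2⟩
    simp [this]
  · have : {x | (pow c t).toFun x = (d : WithBot (Fin n))} = ∅ := by
      ext x
      simp only [mem_ofPred_eq, mem_empty_iff_false, iff_false]
      exact fun hx => h (eq_of_mem_letters_pow (mem_letters_of_toFun_eq hx)).symm
    simp [this]

theorem wt_eq_zero {w : TimedWord n} {c : Fin n} (h : c ∉ w.letters) : w.wt c = 0 := by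
  have : {x | w.toFun x = (c : WithBot (Fin n))} = ∅ :=
    Set.eq_empty_of_forall_notMem fun x hx => h ⟨x, hx⟩
  simp [wt, this]

/-- The total length of the letters of `w` with index less than `j`. -/
noncomputable def cum (w : TimedWord n) (j : ℕ) : ℝ :=
  ∑ c : Fin n, if c.val < j then (w.wt c : ℝ) else 0

@[simp] theorem cum_zero (w : TimedWord n) : w.cum 0 = 0 := by simp [cum]

@[simp] theorem cum_one (j : ℕ) : (1 : TimedWord n).cum j = 0 := by simp [cum]

theorem cum_mul (u v : TimedWord n) (j : ℕ) : (u * v).cum j = u.cum j + v.cum j := by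
  rw [cum, cum, cum, ← Finset.sum_add_distrib]
  refine Finset.sum_congr rfl fun c _ => ?_
  split_ifs <;> simp [wt_mul]

theorem cum_pow (c : Fin n) (t : ℝ≥0) (j : ℕ) :
    (pow c t).cum j = if c.val < j then (t : ℝ) else 0 := by
  rw [cum, Finset.sum_eq_single c]
  · simp [wt_pow]
  · intro d _ hd
    simp [wt_pow, hd.symm]
  · simp

theorem cum_succ (w : TimedWord n) (c : Fin n) : w.cum (c.val + 1) = w.cum c.val + w.wt c := by
  have : ∀ d : Fin n, (if d.val < c.val + 1 then (w.wt d : ℝ) else 0) =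
      (if d.val < c.val then (w.wt d : ℝ) else 0) + if d = c then (w.wt c : ℝ) else 0 := by
    intro d
    rcases lt_trichotomy d c with h | h | h
    · have : d.val < c.val := h
      simp [this, h.ne, Nat.lt_succ_of_lt this]
    · subst h; simp
    · have : c.val < d.val := h
      simp [h.ne', not_lt.2 this.le, not_lt.2 (Nat.succ_le_of_lt this)]
  simp only [cum, this, Finset.sum_add_distrib]
  simp

theorem cum_mono (w : TimedWord n) : Monotone w.cum := fun i j hij => by
  refine Finset.sum_le_sum fun c _ => ?_
  split_ifs with h1 h2
  · exact le_rfl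
  · exact absurd (h1.trans_le hij) h2
  · exact NNReal.coe_nonneg _
  · exact le_rfl

theorem cum_nonneg (w : TimedWord n) (j : ℕ) : 0 ≤ w.cum j :=
  (cum_zero w).symm.le.trans (cum_mono w (Nat.zero_le j))

theorem cum_eq_len_of_letters {w : TimedWord n} {j : ℕ} (h : ∀ c ∈ w.letters, c.val < j) :
    w.cum j = w.len := by
  obtain ⟨E, hE, rfl⟩ := w.exists_expString
  change (ofString E).cum j = (ofString E).len
  change ∀ c ∈ (ofString E).letters, _ at h
  induction E with
  | nil => simp
  | cons p E ih =>
    have := ih (fun q hq => hE q (List.mem_cons_of_mem _ hq)) fun c hc => h c (by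
      rw [ofString_cons, letters_mul]; exact Or.inr hc)
    rw [ofString_cons, cum_mul, len_mul, this, cum_pow, if_pos, len_pow]
    exact h _ (mem_letters_ofString hE List.mem_cons_self)

theorem cum_eq_len {w : TimedWord n} {j : ℕ} (h : n ≤ j) : w.cum j = w.len :=
  cum_eq_len_of_letters fun c _ => c.2.trans_le h

theorem cum_le_len (w : TimedWord n) (j : ℕ) : w.cum j ≤ w.len := by
  rcases le_total n j with h | h
  · exact (cum_eq_len h).le
  · exact (cum_mono w h).trans (cum_eq_len le_rfl).le

theorem cum_eq_zero_of_letters {w : TimedWord n} {j : ℕ} (h : ∀ c ∈ w.letters, j ≤ c.val) :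
    w.cum j = 0 := by
  refine Finset.sum_eq_zero fun c _ => ?_
  split_ifs with hc
  · rw [wt_eq_zero fun hm => absurd (h c hm) (not_le.2 hc), NNReal.coe_zero]
  · rfl

/-- Cut at the threshold `j`, the row has a left piece of length `w.cum j`; the partial sums thus
encode the row as a function. -/
theorem IsRow.lt_cum_iff {w : TimedWord n} (hw : w.IsRow) {x : ℝ} {d : Fin n}
    (hx : w.toFun x = d) (j : ℕ) : x < w.cum j ↔ d.val < j := by
  obtain ⟨A, Z, rfl, -, -, hA, hZ⟩ := hw.exists_split (fun c => c.val < j)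
    fun c d hcd hd => lt_of_le_of_lt hcd hd
  rw [cum_mul, cum_eq_len_of_letters hA, cum_eq_zero_of_letters fun c hc => not_lt.1 (hZ c hc),
    add_zero]
  by_cases h : x < A.len
  · rw [toFun_mul_of_lt _ _ h] at hx
    simpa [h] using hA d ⟨x, hx⟩
  · rw [toFun_mul_of_le _ _ (not_lt.1 h)] at hx
    simpa [h] using hZ d ⟨_, hx⟩

/-- A row is determined by its weight. -/
theorem IsRow.eq_of_wt {u v : TimedWord n} (hu : u.IsRow) (hv : v.IsRow)
    (h : ∀ c, u.wt c = v.wt c) : u = v := by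
  have hcum : ∀ j, u.cum j = v.cum j := fun j => by simp [cum, h]
  have hlen : u.len = v.len := by
    rw [← cum_eq_len le_rfl, ← cum_eq_len le_rfl, hcum]
  apply ext_toFun
  funext x
  by_cases hx : 0 ≤ x ∧ x < u.len
  · obtain ⟨c, hc⟩ := exists_toFun_eq hx.1 hx.2
    obtain ⟨d, hd⟩ := exists_toFun_eq hx.1 (hlen ▸ hx.2)
    have : ∀ j, c.val < j ↔ d.val < j := fun j => by
      rw [← hu.lt_cum_iff hc, ← hv.lt_cum_iff hd, hcum]
    have h1 := (this (d.val + 1)).2 (Nat.lt_succ_self _)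
    have h2 := (this (c.val + 1)).1 (Nat.lt_succ_self _)
    rw [hc, hd, Fin.ext (by omega : c.val = d.val)]
  · rw [toFun_eq_bot _ hx, toFun_eq_bot _ (hlen ▸ hx)]

theorem pairwise_finRange_map (m : Fin n → ℝ≥0) :
    ((List.finRange n).map fun c => (c, m c)).Pairwise fun p q => p.1 ≤ q.1 := by
  rw [List.pairwise_map]
  exact (List.pairwise_lt_finRange n).imp fun h => h.le

theorem wt_ofString_finRange (m : Fin n → ℝ≥0) (d : Fin n) :
    (ofString ((List.finRange n).map fun c => (c, m c))).wt d = m d := by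
  have : ∀ L : List (Fin n), (ofString (L.map fun c => (c, m c))).wt d =
      (L.map fun c => if c = d then m c else 0).sum := by
    intro L
    induction L with
    | nil => simp
    | cons c L ih => simp [wt_mul, wt_pow, ih]
  rw [this, ← List.ofFn_eq_map, List.sum_ofFn]
  simp

/-- The canonical form `1^{m_1} ⋯ n^{m_n}` of a row. -/
theorem IsRow.ofString_wt {v : TimedWord n} (hv : v.IsRow) :
    ofString ((List.finRange n).map fun c => (c, v.wt c)) = v :=
  (isRow_ofString_of_pairwise (pairwise_finRange_map _)).eq_of_wt hv
    fun d => wt_ofString_finRange _ d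

/-- The letters of index `≤ j` in `v` fill `[0, v.cum (j + 1))`, and those of index `< j` in `u`
fill `[0, u.cum j)`; strict increase from `u` to `v` says that the first interval lies in the
second. -/
theorem dominatedBy_iff {u v : TimedWord n} (hu : u.IsRow) (hv : v.IsRow) :
    u.DominatedBy v ↔ ∀ j, v.cum (j + 1) ≤ u.cum j := by
  constructor
  · rintro ⟨hlen, h⟩ j
    by_contra! hlt
    have h1 : u.cum j < v.len := hlt.trans_le (cum_le_len _ _)
    obtain ⟨d, hd⟩ := exists_toFun_eq (cum_nonneg u j) h1
    obtain ⟨e, he⟩ := exists_toFun_eq (cum_nonneg u j) (h1.trans_le hlen)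
    have h2 := h _ (cum_nonneg u j) h1
    rw [hd, he, WithBot.coe_lt_coe] at h2
    have h3 := (hv.lt_cum_iff hd _).1 hlt
    have h4 := (not_congr (hu.lt_cum_iff he j)).1 (lt_irrefl _)
    have : e.val < d.val := h2
    omega
  · refine fun h => ⟨?_, fun t h0 h1 => ?_⟩
    · rw [← cum_eq_len (Nat.le_succ n), ← cum_eq_len le_rfl]
      exact h n
    · obtain ⟨d, hd⟩ := exists_toFun_eq h0 h1
      have h2 := ((hv.lt_cum_iff hd _).2 (Nat.lt_succ_self _)).trans_le (h d)
      obtain ⟨e, he⟩ := exists_toFun_eq h0 (h2.trans_le (cum_le_len _ _))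
      rw [hd, he, WithBot.coe_lt_coe]
      exact (hu.lt_cum_iff he _).1 h2

end Weight

/-! ### Insertion of one block `c^t` into a row. -/

section LetterInsertion

theorem slice_eq {w v : TimedWord n} {a b : ℝ} (ha : 0 ≤ a) (hb : a + v.len = b)
    (hbw : b ≤ w.len) (h : ∀ t, 0 ≤ t → t < v.len → w.toFun (a + t) = v.toFun t) :
    w.slice a b = v := by
  have hv := v.len_nonneg
  have hab : a ≤ b := by linarith
  have hlen : b - a = v.len := by linarith
  apply ext_toFun
  funext t
  simp only [slice, ha, hab, hbw, true_and, hlen]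
  split_ifs with ht
  · exact h t ht.1 ht.2
  · exact (v.toFun_eq_bot ht).symm

theorem slice_zero_mul (u v : TimedWord n) : (u * v).slice 0 u.len = u :=
  slice_eq le_rfl (by simp) (by simp [v.len_nonneg]) fun t _ h1 => by
    rw [zero_add, toFun_mul_of_lt _ _ h1]

theorem slice_mul_len (u v : TimedWord n) : (u * v).slice u.len (u * v).len = v :=
  slice_eq u.len_nonneg (by simp) le_rfl fun _ h0 _ => toFun_mul_add _ _ h0

theorem slice_mul_mul (u v w : TimedWord n) :
    (u * v * w).slice u.len (u.len + v.len) = v :=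
  slice_eq u.len_nonneg rfl (by simp [w.len_nonneg]) fun t h0 h1 => by
    rw [mul_assoc, toFun_mul_add _ _ h0, toFun_mul_of_lt _ _ h1]

theorem sInf_toFun_gt {A Z : TimedWord n} {c : Fin n} (hA : ∀ d ∈ A.letters, d ≤ c)
    (hZ : ∀ d ∈ Z.letters, c < d) (h : 0 < Z.len) :
    sInf {x : ℝ | 0 ≤ x ∧ x < (A * Z).len ∧ (c : WithBot (Fin n)) < (A * Z).toFun x} = A.len := by
  refine IsLeast.csInf_eq ⟨⟨A.len_nonneg, by simpa using h, ?_⟩, ?_⟩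
  · rw [toFun_mul_of_le _ _ le_rfl, sub_self]
    obtain ⟨d, hd⟩ := exists_toFun_eq le_rfl h
    rw [hd, WithBot.coe_lt_coe]
    exact hZ d ⟨0, hd⟩
  · rintro x ⟨h0, -, h2⟩
    by_contra! hlt
    rw [toFun_mul_of_lt _ _ hlt] at h2
    obtain ⟨d, hd⟩ := exists_toFun_eq h0 hlt
    rw [hd, WithBot.coe_lt_coe] at h2
    exact absurd (hA d ⟨x, hd⟩) (not_le.2 h2)

theorem not_forall_toFun_le {A Z : TimedWord n} {c : Fin n} (hZ : ∀ d ∈ Z.letters, c < d)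
    (h : 0 < Z.len) :
    ¬ ∀ x, 0 ≤ x → x < (A * Z).len → (A * Z).toFun x ≤ (c : WithBot (Fin n)) := by
  intro hle
  have := hle A.len A.len_nonneg (by simpa using h)
  obtain ⟨d, hd⟩ := exists_toFun_eq le_rfl h
  rw [toFun_mul_of_le _ _ le_rfl, sub_self, hd, WithBot.coe_le_coe] at this
  exact absurd (hZ d ⟨0, hd⟩) (not_lt.2 this)

/-- `A * Z₁ * Z₂` is a row in which the insertion of `c^t` bumps `Z₁`. -/
structure IsBump (c : Fin n) (t : ℝ≥0) (A Z₁ Z₂ : TimedWord n) : Prop where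
  isRow : (A * Z₁ * Z₂).IsRow
  le : ∀ d ∈ A.letters, d ≤ c
  lt₁ : ∀ d ∈ Z₁.letters, c < d
  lt₂ : ∀ d ∈ Z₂.letters, c < d
  len : Z₁.len = t ∨ Z₁.len ≤ t ∧ Z₂ = 1

/-- The part with letters above `c` is cut at length `t`, and is bumped entirely if it is not longer
than `t`. -/
theorem IsRow.exists_isBump {u : TimedWord n} (hu : u.IsRow) (c : Fin n) (t : ℝ≥0) :
    ∃ A Z₁ Z₂, u = A * Z₁ * Z₂ ∧ IsBump c t A Z₁ Z₂ := by
  obtain ⟨A, Z, rfl, -, -, hA, hZ⟩ := hu.exists_split (fun d => d ≤ c) fun _ _ => le_trans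
  rcases le_or_gt Z.len t with h | h
  · exact ⟨A, Z, 1, by simp, by simpa using hu, hA, fun d hd => not_le.1 (hZ d hd), by simp,
      Or.inr ⟨h, rfl⟩⟩
  · have hs := Z.slice_mul_slice t.2 h.le
    have hl : (Z.slice 0 t).len = t := by simp [slice, h.le]
    rw [← hs] at hu hZ ⊢
    rw [letters_mul] at hZ
    exact ⟨A, _, _, by rw [mul_assoc], by rwa [mul_assoc], hA,
      fun d hd => not_le.1 (hZ d (Or.inl hd)), fun d hd => not_le.1 (hZ d (Or.inr hd)), Or.inl hl⟩

/-- The three cases of `rinsLetter` merge: `Z₁ * Z₂` is empty if no letter exceeds `c`; otherwise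
the remaining length exceeds `t` exactly when `Z₂` is non-empty. -/
theorem IsBump.rinsLetter_eq {c : Fin n} {t : ℝ≥0} {A Z₁ Z₂ : TimedWord n}
    (h : IsBump c t A Z₁ Z₂) :
    rinsLetter (A * Z₁ * Z₂) c t = (Z₁, A * pow c t * Z₂) := by
  have hZ : ∀ d ∈ (Z₁ * Z₂).letters, c < d := by
    rw [letters_mul]
    rintro d (hd | hd)
    · exact h.lt₁ d hd
    · exact h.lt₂ d hd
  rcases (Z₁ * Z₂).len_nonneg.eq_or_lt with h0 | h0
  · have h1 := Z₁.len_nonneg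
    have h2 := Z₂.len_nonneg
    rw [len_mul] at h0
    obtain rfl := Z₁.eq_one_of_len (by linarith)
    obtain rfl := Z₂.eq_one_of_len (by linarith)
    rw [rinsLetter, if_pos]
    · simp
    · intro x hx0 hx1
      rw [mul_one, mul_one] at hx1 ⊢
      obtain ⟨d, hd⟩ := exists_toFun_eq hx0 hx1
      rw [hd, WithBot.coe_le_coe]
      exact h.le d ⟨x, hd⟩
  · have h2 := Z₂.len_nonneg
    have hn := not_forall_toFun_le (A := A) hZ h0
    have ht := sInf_toFun_gt h.le hZ h0
    rw [← mul_assoc] at hn ht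
    rw [rinsLetter, if_neg hn]
    simp only [ht]
    rcases h2.eq_or_lt with h3 | h3
    · obtain rfl := Z₂.eq_one_of_len h3.symm
      have h4 : Z₁.len ≤ t := by
        rcases h.len with h4 | h4
        · exact h4.le
        · exact h4.1
      rw [if_neg (by simpa using h4)]
      simp only [mul_one]
      rw [slice_mul_len, slice_zero_mul]
    · have h4 : Z₁.len = t := by
        rcases h.len with h4 | h4
        · exact h4
        · rw [h4.2] at h3; simp at h3
      rw [if_pos (by simp only [len_mul]; linarith), ← h4, slice_mul_mul, ← len_mul, slice_mul_len,
        mul_assoc A, slice_zero_mul]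

theorem IsBump.isRow_insert {c : Fin n} {t : ℝ≥0} {A Z₁ Z₂ : TimedWord n}
    (h : IsBump c t A Z₁ Z₂) : (A * pow c t * Z₂).IsRow := by
  obtain ⟨h1, h2, h3⟩ := isRow_mul_iff.1 h.isRow
  rw [isRow_mul_iff, isRow_mul_iff]
  refine ⟨⟨(isRow_mul_iff.1 h1).1, isRow_pow _ _, fun d hd e he => ?_⟩, h2, ?_⟩
  · rw [eq_of_mem_letters_pow he]
    exact h.le d hd
  · rw [letters_mul]
    rintro d (hd | hd) e he
    · exact h3 d (by rw [letters_mul]; exact Or.inl hd) e he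
    · rw [eq_of_mem_letters_pow hd]
      exact (h.lt₂ e he).le

/-- Let `j` be above the index of `c`. If `Z₂` has a letter below `j`, all of `Z₁` is below `j` and
has length `t`, so replacing it by `c^t` changes nothing. Otherwise only `A` and `c^t` count, and
`Z₁` counted for at most `t` before. -/
theorem IsBump.cum_insert {c : Fin n} {t : ℝ≥0} {A Z₁ Z₂ : TimedWord n}
    (h : IsBump c t A Z₁ Z₂) (j : ℕ) :
    (A * pow c t * Z₂).cum j = if j ≤ c.val then (A * Z₁ * Z₂).cum j
      else max ((A * Z₁ * Z₂).cum j) ((A * Z₁ * Z₂).cum (c.val + 1) + t) := by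
  have hA : ∀ j, c.val < j → A.cum j = A.len := fun j hj =>
    cum_eq_len_of_letters fun d hd => lt_of_le_of_lt (h.le d hd) hj
  have hZ₁ : ∀ j, j ≤ c.val + 1 → Z₁.cum j = 0 := fun j hj =>
    cum_eq_zero_of_letters fun d hd => hj.trans (h.lt₁ d hd)
  have hZ₂ : ∀ j, j ≤ c.val + 1 → Z₂.cum j = 0 := fun j hj =>
    cum_eq_zero_of_letters fun d hd => hj.trans (h.lt₂ d hd)
  simp only [cum_mul, cum_pow]
  by_cases hj : j ≤ c.val
  · rw [if_neg (by omega), if_pos hj, hZ₁ j (by omega), add_zero]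
  · have hj' : c.val < j := by omega
    rw [if_pos hj', if_neg hj]
    rw [hA j hj', hA _ (Nat.lt_succ_self _), hZ₁ _ le_rfl, hZ₂ _ le_rfl, add_zero, add_zero]
    have h1 := cum_le_len Z₁ j
    rcases h.len with hl | ⟨hl, rfl⟩
    · by_cases hc : ∀ d ∈ Z₂.letters, j ≤ d.val
      · rw [cum_eq_zero_of_letters hc, max_eq_right] <;> linarith
      · push Not at hc
        obtain ⟨d, hd, hdj⟩ := hc
        rw [cum_eq_len_of_letters (w := Z₁) fun e he => lt_of_le_of_lt
          ((isRow_mul_iff.1 h.isRow).2.2 e (by rw [letters_mul]; exact Or.inr he) d hd) hdj,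
          hl, max_eq_left]
        linarith [cum_nonneg Z₂ j]
    · rw [cum_one, max_eq_right] <;> linarith

/-- The insertion of a letter into a row is a sequence of Knuth moves. -/
theorem greeneEquiv_bump_ofString {c : Fin n} {E₀ E₁ E₂ : List (Fin n × ℝ≥0)} {t : ℝ≥0}
    (h₀ : ∀ p ∈ E₀, p.1 ≤ c) (hs₀ : E₀.Pairwise fun p q => p.1 ≤ q.1)
    (h₁ : ∀ p ∈ E₁ ++ E₂, c < p.1) (hs₁ : (E₁ ++ E₂).Pairwise fun p q => p.1 ≤ q.1)
    (ht : (ofString E₁).len = t ∨ (ofString E₁).len ≤ t ∧ ofString E₂ = 1) :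
    GreeneEquiv (ofString E₀ * ofString E₁ * ofString E₂ * pow c t)
      (ofString E₁ * (ofString E₀ * pow c t * ofString E₂)) := by
  induction E₁ generalizing E₀ t with
  | nil =>
    rcases ht with ht | ⟨-, ht⟩
    · have : t = 0 := by simpa using ht.symm
      subst this
      simp only [pow_zero, ofString_nil, mul_one, one_mul]
      exact GreeneEquiv.refl _
    · simp only [ht, ofString_nil, mul_one, one_mul]
      exact GreeneEquiv.refl _
  | cons p E₁ ih =>
    obtain ⟨b, r⟩ := p
    have hl := (ofString E₁).len_nonneg
    rw [ofString_cons, len_mul, len_pow] at ht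
    have hrt : r ≤ t := by
      rw [← NNReal.coe_le_coe]
      rcases ht with ht | ⟨ht, -⟩ <;> simp only at ht <;> linarith
    -- The Knuth relations need equal exponents, so `c^t` is split as `c^r c^s`: the factor `c^r`
    -- travels left to `b^r`, then `b^r` passes to the front, and `c^s` is left to the induction.
    obtain ⟨s, rfl⟩ := exists_add_of_le hrt
    rw [NNReal.coe_add] at ht
    simp only [List.cons_append, List.mem_cons, List.pairwise_cons] at h₁ hs₁
    have hcb : c < b := h₁ (b, r) (Or.inl rfl)
    have key := ih (E₀ := E₀ ++ [(c, r)]) (t := s)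
      (fun q hq => by
        rcases List.mem_append.1 hq with hq | hq
        · exact h₀ q hq
        · rw [List.mem_singleton.1 hq])
      (List.pairwise_append.2 ⟨hs₀, List.pairwise_singleton _ _, fun q hq q' hq' => by
        rw [List.mem_singleton.1 hq']; exact h₀ q hq⟩)
      (fun q hq => h₁ q (Or.inr hq)) hs₁.2
      (ht.imp (fun h => by simp only at h; linarith)
        fun h => ⟨by have := h.1; simp only at this; linarith, h.2⟩)
    have k1 := GreeneEquiv.knuth_right hcb r hs₁.1 hs₁.2
    have k2 := GreeneEquiv.knuth_left hcb r h₀ hs₀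
    have k1' := (k1.mul_left (ofString E₀)).mul_right (pow c s)
    have k2' := (k2.mul_right (ofString (E₁ ++ E₂))).mul_right (pow c s)
    have key' := key.mul_left (pow b r)
    simp only [ofString_append, ofString_cons, ofString_nil, mul_one, pow_add, mul_assoc]
      at k1' k2' key' ⊢
    exact (k1'.trans k2').trans key'

theorem IsBump.greeneEquiv {c : Fin n} {t : ℝ≥0} {A Z₁ Z₂ : TimedWord n}
    (h : IsBump c t A Z₁ Z₂) :
    GreeneEquiv (A * Z₁ * Z₂ * pow c t) (Z₁ * (A * pow c t * Z₂)) := by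
  obtain ⟨h1, h2, h3, h4, h5⟩ := h
  obtain ⟨E₀, hE₀, rfl⟩ := A.exists_expString
  obtain ⟨E₁, hE₁, rfl⟩ := Z₁.exists_expString
  obtain ⟨E₂, hE₂, rfl⟩ := Z₂.exists_expString
  rw [mul_assoc] at h1
  have hpos : ∀ p ∈ E₁ ++ E₂, 0 < p.2 := fun p hp => (List.mem_append.1 hp).elim (hE₁ p) (hE₂ p)
  refine greeneEquiv_bump_ofString (fun p hp => h2 _ (mem_letters_ofString hE₀ hp))
    (IsRow.pairwise (isRow_mul_iff.1 h1).1 hE₀) (fun p hp => ?_)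
    (IsRow.pairwise (by rw [ofString_append]; exact h1.right) hpos) h5
  rcases List.mem_append.1 hp with hp | hp
  · exact h3 _ (mem_letters_ofString hE₁ hp)
  · exact h4 _ (mem_letters_ofString hE₂ hp)

end LetterInsertion

/-! ### Insertion of a row into a row, in terms of partial sums. -/

section RowInsertion

/-- The effect of successive insertions on a row `R`, when `B` has been bumped out before. -/
theorem foldl_rinsLetter {E : List (Fin n × ℝ≥0)} (hE : E.Pairwise fun p q => p.1 ≤ q.1)
    {B R : TimedWord n} (hB : B.IsRow) (hR : R.IsRow)
    (hBR : ∀ p ∈ E, ∀ b ∈ B.letters, ∀ r ∈ R.letters, p.1 < r → b ≤ r)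
    {B' R' : TimedWord n} (h : E.foldl (fun q p =>
      (q.1 * (rinsLetter q.2 p.1 p.2).1, (rinsLetter q.2 p.1 p.2).2)) (B, R) = (B', R')) :
    B'.IsRow ∧ R'.IsRow ∧ GreeneEquiv (B * R * ofString E) (B' * R') ∧
      ∀ j, B'.cum j + R'.cum j = B.cum j + R.cum j + (ofString E).cum j := by
  induction E generalizing B R with
  | nil =>
    obtain ⟨rfl, rfl⟩ := Prod.mk.inj h
    exact ⟨hB, hR, by simpa using GreeneEquiv.refl _, by simp⟩
  | cons p E ih =>
    obtain ⟨c, t⟩ := p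
    obtain ⟨A, Z₁, Z₂, rfl, hb⟩ := hR.exists_isBump c t
    rw [List.foldl_cons] at h
    simp only [hb.rinsLetter_eq] at h
    rw [List.pairwise_cons] at hE
    have hBR' := hBR (c, t) List.mem_cons_self
    simp only [letters_mul] at hBR'
    have hrow := isRow_mul_iff.1 hb.isRow
    obtain ⟨h1, h2, h3, h4⟩ := ih hE.2
      (isRow_mul_iff.2 ⟨hB, hrow.1.right, fun b hb' d hd =>
        hBR' b hb' d (Or.inl (Or.inr hd)) (hb.lt₁ d hd)⟩) hb.isRow_insert
      (by
        -- A letter of the new row above the next inserted letter `p.1 ≥ c` comes from `Z₂`, and is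
        -- thus at least every letter of `B` and of `Z₁`.
        intro p hp b hb' r hr hpr
        have hcp : c ≤ p.1 := hE.1 p hp
        simp only [letters_mul] at hb' hr
        rcases hr with (hr | hr) | hr
        · exact absurd ((hb.le r hr).trans hcp) (not_le.2 hpr)
        · rw [eq_of_mem_letters_pow hr] at hpr
          exact absurd hcp (not_le.2 hpr)
        · rcases hb' with hb' | hb'
          · exact hBR' b hb' r (Or.inr hr) (hb.lt₂ r hr)
          · exact hrow.2.2 b (by rw [letters_mul]; exact Or.inr hb') r hr) h
    refine ⟨h1, h2, ?_, fun j => ?_⟩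
    · have := (hb.greeneEquiv.mul_left B).mul_right (ofString E)
      simp only [ofString_cons, mul_assoc] at this h3 ⊢
      exact this.trans h3
    · rw [h4]
      simp only [ofString_cons, cum_mul]
      ring

theorem rins_spec {u v : TimedWord n} (hu : u.IsRow) (hv : v.IsRow) :
    (rins u v).1.IsRow ∧ (rins u v).2.IsRow ∧
      GreeneEquiv (u * v) ((rins u v).1 * (rins u v).2) ∧
      ∀ j, (rins u v).1.cum j + (rins u v).2.cum j = u.cum j + v.cum j := by
  have := foldl_rinsLetter (pairwise_finRange_map v.wt) isRow_one hu (by simp)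
    (B' := (rins u v).1) (R' := (rins u v).2) rfl
  simpa only [hv.ofString_wt, one_mul, cum_one, zero_add] using this

/-- The partial sums of the weight of the row that arises by inserting a row with partial sums
`V` into a row with partial sums `U`. -/
noncomputable def insCum (U V : ℕ → ℝ) : ℕ → ℝ
  | 0 => 0
  | j + 1 => max (insCum U V j) (U (j + 1)) + (V (j + 1) - V j)

/-- By `IsBump.cum_insert`, inserting the letter of index `m` leaves the partial sums up to `m`
alone and raises all later ones to at least the new value at `m + 1`. After all `n` letters only
`insCum` remains. -/
theorem cum_rinsString_take {u v : TimedWord n} (hu : u.IsRow) {m : ℕ} (hm : m ≤ n) :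
    (rinsString u (((List.finRange n).take m).map fun c => (c, v.wt c))).2.IsRow ∧
    ∀ j, (rinsString u (((List.finRange n).take m).map fun c => (c, v.wt c))).2.cum j =
      if j ≤ m then insCum u.cum v.cum j else max (insCum u.cum v.cum m) (u.cum j) := by
  induction m with
  | zero =>
    refine ⟨hu, fun j => ?_⟩
    change u.cum j = _
    split_ifs with h
    · rw [Nat.le_zero.1 h, insCum, cum_zero]
    · rw [insCum, max_eq_right (cum_nonneg u j)]
  | succ m ih =>
    obtain ⟨hR, ih⟩ := ih (Nat.le_of_succ_le hm)
    have hlen : m < (List.finRange n).length := by simpa using hm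
    have hget : (List.finRange n)[m] = ⟨m, hm⟩ := by simp
    set q := rinsString u (((List.finRange n).take m).map fun c => (c, v.wt c)) with hq
    have hstep : (rinsString u (((List.finRange n).take (m + 1)).map fun c => (c, v.wt c))).2 =
        (rinsLetter q.2 ⟨m, hm⟩ (v.wt ⟨m, hm⟩)).2 := by
      rw [List.take_succ_eq_append_getElem hlen, List.map_append, rinsString, List.foldl_append,
        hget]
      rfl
    rw [hstep]
    obtain ⟨A, Z₁, Z₂, hAZ, hb⟩ := hR.exists_isBump ⟨m, hm⟩ (v.wt ⟨m, hm⟩)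
    rw [hAZ, hb.rinsLetter_eq]
    refine ⟨hb.isRow_insert, fun j => ?_⟩
    rw [hb.cum_insert, ← hAZ]
    have hv := cum_succ v ⟨m, hm⟩
    simp only at hv ⊢
    simp only [ih]
    rcases lt_trichotomy j (m + 1) with h | h | h
    · rw [if_pos (by omega), if_pos (by omega), if_pos (by omega)]
    · subst h
      rw [if_neg (by omega), if_neg (by omega), if_pos le_rfl, insCum, hv, add_sub_cancel_left,
        max_eq_right]
      linarith [NNReal.coe_nonneg (v.wt ⟨m, hm⟩)]
    · rw [if_neg (by omega), if_neg (by omega), if_neg (by omega), if_neg (by omega), insCum, hv,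
        add_sub_cancel_left]
      have h1 : u.cum (m + 1) ≤ u.cum j := cum_mono u (by omega)
      have h2 := NNReal.coe_nonneg (v.wt ⟨m, hm⟩)
      refine le_antisymm (max_le (max_le ?_ (le_max_right _ _)) (le_max_left _ _))
        (max_le (le_max_right _ _) ((le_max_right _ _).trans (le_max_left _ _)))
      exact le_max_of_le_left ((le_max_left _ _).trans (le_add_of_nonneg_right h2))

theorem cum_rins {u v : TimedWord n} (hu : u.IsRow) {j : ℕ} (hj : j ≤ n) :
    (rins u v).2.cum j = insCum u.cum v.cum j := by
  have := (cum_rinsString_take (v := v) hu (le_refl n)).2 j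
  rw [List.take_of_length_le (by simp), if_pos hj] at this
  exact this

theorem cum_eq_cum_of_le {w : TimedWord n} {j : ℕ} (h : n ≤ j) : w.cum j = w.cum n := by
  rw [cum_eq_len h, cum_eq_len le_rfl]

/-- Partial sums are constant from `n` on, so the case `j = n - 1` covers all later ones. -/
theorem dominatedBy_of_cum {u v : TimedWord n} (hu : u.IsRow) (hv : v.IsRow)
    (h : ∀ j < n, v.cum (j + 1) ≤ u.cum j) : u.DominatedBy v := by
  refine (dominatedBy_iff hu hv).2 fun j => ?_
  rcases lt_or_ge j n with hj | hj
  · exact h j hj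
  · rw [cum_eq_cum_of_le (j := j + 1) (by omega), cum_eq_cum_of_le hj]
    cases n with
    | zero => simp
    | succ n => exact (h n (by omega)).trans (cum_mono u (by omega))

theorem insCum_succ_ge_left (U V : ℕ → ℝ) (j : ℕ) :
    insCum U V j + (V (j + 1) - V j) ≤ insCum U V (j + 1) := by
  rw [insCum]; linarith [le_max_left (insCum U V j) (U (j + 1))]

theorem insCum_succ_ge_right (U V : ℕ → ℝ) (j : ℕ) :
    U (j + 1) + (V (j + 1) - V j) ≤ insCum U V (j + 1) := by
  rw [insCum]; linarith [le_max_right (insCum U V j) (U (j + 1))]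

theorem le_insCum {U V : ℕ → ℝ} (hV : V 0 = 0) (j : ℕ) : V j ≤ insCum U V j := by
  induction j with
  | zero => rw [hV, insCum]
  | succ j ih => linarith [insCum_succ_ge_left U V j]

theorem cum_fst_rins {u v : TimedWord n} (hu : u.IsRow) (hv : v.IsRow) {j : ℕ} (hj : j ≤ n) :
    (rins u v).1.cum j = u.cum j + v.cum j - insCum u.cum v.cum j := by
  have := (rins_spec hu hv).2.2.2 j
  rw [cum_rins hu hj] at this
  linarith

/-- The two rows that result from a row insertion form a tableau. -/
theorem dominatedBy_rins {u v : TimedWord n} (hu : u.IsRow) (hv : v.IsRow) :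
    (rins u v).2.DominatedBy (rins u v).1 := by
  obtain ⟨h1, h2, -, -⟩ := rins_spec hu hv
  refine dominatedBy_of_cum h2 h1 fun j hj => ?_
  rw [cum_fst_rins hu hv (by omega), cum_rins hu (by omega)]
  linarith [insCum_succ_ge_right u.cum v.cum j, le_insCum (U := u.cum) (cum_zero v) j]

/-- Row insertion preserves the relation `u₁ ◁ u₂`. -/
theorem DominatedBy.rins {u₁ u₂ v : TimedWord n} (h : u₁.DominatedBy u₂) (hu₁ : u₁.IsRow)
    (hu₂ : u₂.IsRow) (hv : v.IsRow) :
    (TimedWord.rins u₁ v).2.DominatedBy (TimedWord.rins u₂ (TimedWord.rins u₁ v).1).2 := by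
  obtain ⟨h1, h2, -, -⟩ := rins_spec hu₁ hv
  set v₁ := (TimedWord.rins u₁ v).1 with hv₁
  have hdom := (dominatedBy_iff hu₁ hu₂).1 h
  refine dominatedBy_of_cum h2 (rins_spec hu₂ h1).2.1 fun j hj => ?_
  -- In the recursion for `u₂`, the first term of the maximum is handled by induction and the second
  -- by `u₁ ◁ u₂` together with conservation of weight in the insertion into `u₁`.
  have key : ∀ j < n, insCum u₂.cum v₁.cum (j + 1) - v₁.cum (j + 1) ≤
      insCum u₁.cum v.cum j - v.cum j := by
    intro j hj
    induction j with
    | zero =>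
      have := hdom 0
      have h0 : insCum u₂.cum v₁.cum 0 = 0 := rfl
      have h0' : insCum u₁.cum v.cum 0 = 0 := rfl
      rw [h0', insCum, h0]
      simp only [cum_zero] at this ⊢
      rw [max_eq_left this]
      linarith
    | succ j ih =>
      have ih := ih (by omega)
      have h3 := hdom (j + 1)
      have h4 := cum_fst_rins hu₁ hv (j := j + 1) (by omega)
      have h5 := insCum_succ_ge_left u₁.cum v.cum j
      rw [← hv₁] at h4
      rw [insCum]
      rcases max_cases (insCum u₂.cum v₁.cum (j + 1)) (u₂.cum (j + 1 + 1)) with h | h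
      · rw [h.1]; linarith
      · rw [h.1]; linarith
  rw [cum_rins hu₂ (by omega), cum_rins hu₁ (by omega)]
  have h3 := key j hj
  have h4 := cum_fst_rins hu₁ hv (j := j + 1) (by omega)
  rw [← hv₁] at h4
  linarith [insCum_succ_ge_right u₁.cum v.cum j]

end RowInsertion

/-! ### The insertion tableau is a tableau Greene equivalent to the word. -/

section Tableau

theorem DominatedBy.trans {u v w : TimedWord n} (h : u.DominatedBy v) (h' : v.DominatedBy w) :
    u.DominatedBy w :=
  ⟨h'.1.trans h.1, fun t h0 h1 => (h.2 t h0 (h1.trans_le h'.1)).trans (h'.2 t h0 h1)⟩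

instance : IsTrans (TimedWord n) DominatedBy := ⟨fun _ _ _ => DominatedBy.trans⟩

/-- The first letters already form a descent. Hence non-empty rows that dominate one another are the
row decomposition of their product. -/
theorem DominatedBy.not_isRow_mul {u v : TimedWord n} (h : u.DominatedBy v) (hv : 0 < v.len) :
    ¬ (v * u).IsRow := by
  intro hr
  have h1 := h.2 0 le_rfl hv
  obtain ⟨c, hc⟩ := exists_toFun_eq le_rfl hv
  obtain ⟨d, hd⟩ := exists_toFun_eq le_rfl (hv.trans_le h.1)
  rw [hc, hd, WithBot.coe_lt_coe] at h1
  exact absurd ((isRow_mul_iff.1 hr).2.2 c ⟨0, hc⟩ d ⟨0, hd⟩) (not_le.2 h1)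

theorem prod_filter_len_pos (L : List (TimedWord n))
    [DecidablePred fun u : TimedWord n => 0 < u.len] :
    (L.filter fun u => 0 < u.len).prod = L.prod := by
  induction L with
  | nil => rfl
  | cons u L ih =>
    rw [List.filter_cons]
    split_ifs with h
    · rw [List.prod_cons, List.prod_cons, ih]
    · rw [ih, List.prod_cons, u.eq_one_of_len (le_antisymm (by simpa using h) u.len_nonneg),
        one_mul]

theorem IsRowDecomposition.rowDecomposition_eq {w : TimedWord n} {M : List (TimedWord n)}
    (h : w.IsRowDecomposition M) : w.rowDecomposition = M :=
  w.rowDecomposition_spec.unique h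

/-- Rows `u_1 ◁ u_2 ◁ ⋯ ◁ u_l`, some of which may be empty, form a tableau `u_l ⋯ u_1`. -/
theorem isTableau_prod_reverse {L : List (TimedWord n)} (hrow : ∀ u ∈ L, u.IsRow)
    (hdom : L.IsChain DominatedBy) : L.reverse.prod.IsTableau := by
  classical
  -- By transitivity domination holds pairwise, a condition that survives the removal of empty rows.
  have hp : (L.reverse.filter fun u => 0 < u.len).Pairwise fun u v => v.DominatedBy u :=
    (List.pairwise_reverse.2 (List.isChain_iff_pairwise.1 hdom)).filter _
  have hdec : L.reverse.prod.IsRowDecomposition (L.reverse.filter fun u => 0 < u.len) := by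
    refine ⟨prod_filter_len_pos _, fun u hu => ?_, ?_⟩
    · rw [List.mem_filter, List.mem_reverse] at hu
      exact ⟨by simpa using hu.2, hrow u hu.1⟩
    · refine (List.Pairwise.imp_of_mem (fun {u v} hu _ h => ?_) hp).isChain
      rw [List.mem_filter] at hu
      exact h.not_isRow_mul (by simpa using hu.2)
  rw [IsTableau, hdec.rowDecomposition_eq]
  exact hp.isChain

theorem IsRow.isTableau {u : TimedWord n} (hu : u.IsRow) : u.IsTableau := by
  have := isTableau_prod_reverse (L := [u]) (by simpa using hu) (List.isChain_singleton _)
  simpa using this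

/-- The rows `[u_1', …, u_l', v_l']` that arise in the insertion of `v` into the rows
`[u_1, …, u_l]`. -/
noncomputable def insertedRows : List (TimedWord n) → TimedWord n → List (TimedWord n)
  | [], v => [v]
  | u :: us, v => (rins u v).2 :: insertedRows us (rins u v).1

theorem insertRows_eq (us : List (TimedWord n)) (v : TimedWord n) :
    insertRows us v = (insertedRows us v).reverse.prod := by
  induction us generalizing v with
  | nil => simp [insertRows, insertedRows]
  | cons u us ih => simp [insertRows, insertedRows, ih]

theorem isRow_of_mem_insertedRows {us : List (TimedWord n)} (hus : ∀ u ∈ us, u.IsRow)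
    {v : TimedWord n} (hv : v.IsRow) : ∀ u ∈ insertedRows us v, u.IsRow := by
  induction us generalizing v with
  | nil => simpa [insertedRows] using hv
  | cons u us ih =>
    obtain ⟨h1, h2, -, -⟩ := rins_spec (hus u List.mem_cons_self) hv
    intro x hx
    rcases List.mem_cons.1 hx with rfl | hx
    · exact h2
    · exact ih (fun y hy => hus y (List.mem_cons_of_mem _ hy)) h1 x hx

theorem isChain_insertedRows {us : List (TimedWord n)} (hus : ∀ u ∈ us, u.IsRow)
    (hdom : us.IsChain DominatedBy) {v : TimedWord n} (hv : v.IsRow) :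
    (insertedRows us v).IsChain DominatedBy := by
  induction us generalizing v with
  | nil => exact List.isChain_singleton _
  | cons u us ih =>
    have hu := hus u List.mem_cons_self
    have hus' : ∀ x ∈ us, x.IsRow := fun x hx => hus x (List.mem_cons_of_mem _ hx)
    have ih := ih hus' hdom.tail (rins_spec hu hv).1
    cases us with
    | nil => exact List.isChain_cons_cons.2 ⟨dominatedBy_rins hu hv, ih⟩
    | cons u₂ us =>
      exact List.isChain_cons_cons.2 ⟨(List.isChain_cons_cons.1 hdom).1.rins hu
        (hus' u₂ List.mem_cons_self) hv, ih⟩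

/-- Each row insertion replaces `u_i v_{i-1}'` by `v_i' u_i'`, so the inserted row passes through
the tableau word from right to left. -/
theorem greeneEquiv_insertRows {us : List (TimedWord n)} (hus : ∀ u ∈ us, u.IsRow)
    {v : TimedWord n} (hv : v.IsRow) :
    GreeneEquiv (us.reverse.prod * v) (insertRows us v) := by
  induction us generalizing v with
  | nil => simpa [insertRows] using GreeneEquiv.refl v
  | cons u us ih =>
    obtain ⟨h1, -, h3, -⟩ := rins_spec (hus u List.mem_cons_self) hv
    have h4 := (ih (fun x hx => hus x (List.mem_cons_of_mem _ hx)) h1).mul_right (rins u v).2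
    have h5 := h3.mul_left us.reverse.prod
    rw [insertRows]
    simp only [List.reverse_cons, List.prod_append, List.prod_singleton, mul_assoc] at h4 h5 ⊢
    exact h5.trans h4

theorem isRow_of_mem_rowDecomposition {w u : TimedWord n} (h : u ∈ w.rowDecomposition) :
    u.IsRow :=
  (w.rowDecomposition_spec.2.1 u h).2

theorem IsTableau.isChain {w : TimedWord n} (h : w.IsTableau) :
    w.rowDecomposition.reverse.IsChain DominatedBy :=
  List.isChain_reverse.2 h

theorem IsTableau.insert {w v : TimedWord n} (h : w.IsTableau) (hv : v.IsRow) :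
    (w.insert v).IsTableau ∧ GreeneEquiv (w * v) (w.insert v) := by
  have hrow : ∀ u ∈ w.rowDecomposition.reverse, u.IsRow := fun u hu =>
    isRow_of_mem_rowDecomposition (List.mem_reverse.1 hu)
  constructor
  · rw [TimedWord.insert, insertRows_eq]
    exact isTableau_prod_reverse (isRow_of_mem_insertedRows hrow hv)
      (isChain_insertedRows hrow h.isChain hv)
  · have := greeneEquiv_insertRows hrow hv
    rwa [List.reverse_reverse, w.rowDecomposition_spec.1] at this

theorem IsTableau.foldl_insert {w : TimedWord n} (h : w.IsTableau) {us : List (TimedWord n)}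
    (hus : ∀ u ∈ us, u.IsRow) :
    (us.foldl TimedWord.insert w).IsTableau ∧
      GreeneEquiv (w * us.prod) (us.foldl TimedWord.insert w) := by
  induction us generalizing w with
  | nil => exact ⟨h, by simpa using GreeneEquiv.refl w⟩
  | cons u us ih =>
    obtain ⟨h1, h2⟩ := h.insert (hus u List.mem_cons_self)
    obtain ⟨h3, h4⟩ := ih h1 fun x hx => hus x (List.mem_cons_of_mem _ hx)
    refine ⟨h3, ?_⟩
    rw [List.prod_cons, ← mul_assoc]
    exact (h2.mul_right us.prod).trans h4

theorem insertionTableau_spec (w : TimedWord n) :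
    w.insertionTableau.IsTableau ∧ GreeneEquiv w w.insertionTableau := by
  have hprod := w.rowDecomposition_spec.1
  have hrow := fun u => isRow_of_mem_rowDecomposition (w := w) (u := u)
  rw [insertionTableau]
  generalize w.rowDecomposition = M at hprod hrow
  cases M with
  | nil => exact ⟨isRow_one.isTableau, by rw [← hprod]; exact GreeneEquiv.refl _⟩
  | cons u us =>
    have := (hrow u List.mem_cons_self).isTableau.foldl_insert
      fun x hx => hrow x (List.mem_cons_of_mem _ hx)
    rwa [← List.prod_cons, hprod] at this

end Tableau

/-! ### The first `k` rows of a tableau as chains. -/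

section LowerBound

theorem exists_isChainFamily_rows {k : ℕ} {M : List (TimedWord n)} (hM : ∀ u ∈ M, u.IsRow)
    (hk : M.length ≤ k) : ∃ S : Fin k → Set ℝ, IsChainFamily M.prod (fun _ => ⊥) S ∧
      (∀ i, IsIntervalUnion (S i)) ∧ (∀ i : Fin k, M.length ≤ i.val → S i = ∅) ∧
      ∑ i, volume.real (S i) = (M.map len).sum := by
  induction M with
  | nil =>
    exact ⟨fun _ => ∅, ⟨by simp, by simp, fun _ => Set.subsingleton_empty.monotoneOn _, by simp⟩,
      fun _ => isIntervalUnion_empty, by simp, by simp⟩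
  | cons u M ih =>
    obtain ⟨S, h1, h2, h3, h4⟩ := ih (fun x hx => hM x (List.mem_cons_of_mem _ hx))
      (Nat.le_of_succ_le hk)
    -- This chain is still free, as only those of index below `M.length` are in use.
    let i : Fin k := ⟨M.length, hk⟩
    have hi : S i = ∅ := h3 i le_rfl
    rw [List.prod_cons]
    refine ⟨_, h1.union (hM u List.mem_cons_self) i (σ := fun _ => ⊥) (fun _ => le_rfl)
      (fun _ _ _ => bot_le) (fun x _ _ y hy => absurd hy (by simp [hi])),
      isIntervalUnion_union h1 h2 i, fun j hj => ?_, ?_⟩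
    · have hji : j ≠ i := fun h => by simp [h, i] at hj
      simp [hji, h3 j (Nat.le_of_succ_le hj)]
    · rw [h1.sum_volume_union fun j => (h2 j).measurableSet, h4, List.map_cons, List.sum_cons]

theorem greeneAchieves_prod_reverse (k : ℕ) {L : List (TimedWord n)} (hL : ∀ u ∈ L, u.IsRow) :
    GreeneAchieves k L.reverse.prod ((L.take k).map len).sum := by
  obtain ⟨S, h1, h2, -, h4⟩ := exists_isChainFamily_rows (k := k) (M := (L.take k).reverse)
    (fun u hu => hL u (List.mem_of_mem_take (List.mem_reverse.1 hu))) (by simp)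
  have hprod : L.reverse.prod = (L.drop k).reverse.prod * (L.take k).reverse.prod := by
    rw [← List.prod_append, ← List.reverse_append, List.take_append_drop]
  rw [hprod]
  -- The first `k` rows are a suffix of the tableau word, so their chains are only translated.
  refine ⟨_, h1.image_add _, fun i => (h2 i).image_add _, ?_⟩
  simp_rw [volume_real_image_add]
  rw [h4, List.map_reverse, List.sum_reverse]

end LowerBound

/-! ### Chains meet the columns of a tableau at most once. -/

section UpperBound

/-- The number of rows of `u_l ⋯ u_1` whose point at time `t` lies in `S`. -/
noncomputable def columnCount : List (TimedWord n) → Set ℝ → ℝ → ℝ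
  | [], _, _ => 0
  | u :: M, S, t => (Ico 0 u.len ∩ S).indicator (fun _ => (1 : ℝ)) t +
      columnCount M ((fun x => u.len + x) ⁻¹' S) t

theorem volume_eq_integral_columnCount (M : List (TimedWord n)) {S : Set ℝ}
    (hS : MeasurableSet S) : Integrable (columnCount M S) ∧
      volume.real (Ico 0 M.prod.len ∩ S) = ∫ t, columnCount M S t := by
  induction M generalizing S with
  | nil => simp [columnCount]
  | cons u M ih =>
    have hT : MeasurableSet ((fun x => u.len + x) ⁻¹' S) := measurable_const_add _ hS
    obtain ⟨h1, h2⟩ := ih hT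
    have hm : MeasurableSet (Ico 0 u.len ∩ S) := measurableSet_Ico.inter hS
    have hint : Integrable ((Ico 0 u.len ∩ S).indicator fun _ => (1 : ℝ)) :=
      (integrable_indicator_iff hm).2
        (integrableOn_const (volume_ne_top_of_subset_Ico Set.inter_subset_left))
    refine ⟨hint.add h1, ?_⟩
    have himg : Ico u.len (u.len + M.prod.len) ∩ S =
        (fun x => u.len + x) '' (Ico 0 M.prod.len ∩ (fun x => u.len + x) ⁻¹' S) := by
      rw [Set.image_inter_preimage, Set.image_const_add_Ico, add_zero]
    simp only [columnCount]
    rw [integral_add hint h1, integral_indicator_const _ hm, ← h2, List.prod_cons, len_mul,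
      volume_Ico_inter_add u.len_nonneg (by linarith [M.prod.len_nonneg]), himg,
      volume_real_image_add]
    simp

/-- Applied with `c` the letter at which a chain meets the column: the letters of the column further
to the right are smaller, hence out of reach for the chain. -/
theorem columnCount_eq_zero {M : List (TimedWord n)} {S : Set ℝ} {t : ℝ} {c : WithBot (Fin n)}
    (hM : ∀ v ∈ M, 0 ≤ t → t < v.len → v.toFun t < c)
    (hS : ∀ y ∈ S, 0 ≤ y → y < M.prod.len → c ≤ M.prod.toFun y) : columnCount M S t = 0 := by
  induction M generalizing S with
  | nil => rfl
  | cons u M ih =>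
    rw [columnCount, ih (fun v hv => hM v (List.mem_cons_of_mem _ hv)), add_zero,
      Set.indicator_of_notMem]
    · rintro ⟨⟨h0, h1⟩, h2⟩
      have := hS t h2 h0 (by rw [List.prod_cons, len_mul]; linarith [M.prod.len_nonneg])
      rw [List.prod_cons, toFun_mul_of_lt _ _ h1] at this
      exact absurd (hM u List.mem_cons_self h0 h1) (not_lt.2 this)
    · intro y hy h0 h1
      have := hS _ hy (by linarith [u.len_nonneg]) (by rw [List.prod_cons, len_mul]; linarith)
      rwa [List.prod_cons, toFun_mul_add _ _ h0] at this

/-- A chain meets every column of a tableau at most once. -/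
theorem columnCount_le_one {M : List (TimedWord n)} (hM : M.Pairwise fun u v => v.DominatedBy u)
    {S : Set ℝ} (hS : MonotoneOn M.prod.toFun (Ico 0 M.prod.len ∩ S)) (t : ℝ) :
    columnCount M S t ≤ 1 := by
  induction M generalizing S with
  | nil => exact zero_le_one
  | cons u M ih =>
    rw [List.pairwise_cons] at hM
    have hmem : ∀ y, 0 ≤ y → y < M.prod.len → u.len + y ∈ S →
        u.len + y ∈ Ico 0 (u :: M).prod.len ∩ S := fun y h0 h1 hy =>
      ⟨⟨by linarith [u.len_nonneg], by rw [List.prod_cons, len_mul]; linarith⟩, hy⟩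
    rw [columnCount]
    by_cases ht : t ∈ Ico 0 u.len ∩ S
    · rw [Set.indicator_of_mem ht, columnCount_eq_zero (c := u.toFun t), add_zero]
      · exact fun v hv h0 _ => (hM.1 v hv).2 t h0 ht.1.2
      · intro y hy h0 h1
        have := hS ⟨⟨ht.1.1, by
          rw [List.prod_cons, len_mul]; linarith [ht.1.2, M.prod.len_nonneg]⟩, ht.2⟩
          (hmem y h0 h1 hy) (by linarith [ht.1.2])
        rwa [List.prod_cons, toFun_mul_of_lt _ _ ht.1.2, toFun_mul_add _ _ h0] at this
    · rw [Set.indicator_of_notMem ht, zero_add]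
      refine ih hM.2 fun x hx y hy hxy => ?_
      have := hS (hmem x hx.1.1 hx.1.2 hx.2) (hmem y hy.1.1 hy.1.2 hy.2) (by linarith)
      rwa [List.prod_cons, toFun_mul_add _ _ hx.1.1, toFun_mul_add _ _ hy.1.1] at this

theorem sum_indicator_le {k : ℕ} {A : Set ℝ} {S : Fin k → Set ℝ}
    (hd : ∀ i j, i ≠ j → Disjoint (S i) (S j)) (t : ℝ) :
    ∑ i, (A ∩ S i).indicator (fun _ => (1 : ℝ)) t ≤ A.indicator (fun _ => 1) t := by
  by_cases h : ∃ i, t ∈ A ∩ S i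
  · obtain ⟨i, hi⟩ := h
    rw [Finset.sum_eq_single i, Set.indicator_of_mem hi, Set.indicator_of_mem hi.1]
    · intro j _ hj
      exact Set.indicator_of_notMem (fun h => Set.disjoint_left.1 (hd j i hj) h.2 hi.2) _
    · simp
  · rw [Finset.sum_eq_zero fun i _ => Set.indicator_of_notMem (fun hi => h ⟨i, hi⟩) _]
    exact Set.indicator_nonneg (fun _ _ => zero_le_one) t

theorem sum_columnCount_le (M : List (TimedWord n)) {k : ℕ} {S : Fin k → Set ℝ}
    (hd : ∀ i j, i ≠ j → Disjoint (S i) (S j)) (t : ℝ) :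
    ∑ i, columnCount M (S i) t ≤
      (M.map fun u => (Ico 0 u.len).indicator (fun _ => (1 : ℝ)) t).sum := by
  induction M generalizing S with
  | nil => simp [columnCount]
  | cons u M ih =>
    simp only [columnCount, Finset.sum_add_distrib, List.map_cons, List.sum_cons]
    exact add_le_add (sum_indicator_le hd t) (ih fun i j hij => (hd i j hij).preimage _)

/-- Row lengths decrease along `L`, so the rows that reach time `t` come first, and the right-hand
side is the minimum of `k` and the height of the column. -/
theorem le_sum_take {L : List (TimedWord n)} (hL : L.Pairwise DominatedBy) {t x : ℝ} {k : ℕ}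
    (hk : x ≤ k) (hx : x ≤ (L.map fun u => (Ico 0 u.len).indicator (fun _ => (1 : ℝ)) t).sum) :
    x ≤ ((L.take k).map fun u => (Ico 0 u.len).indicator (fun _ => (1 : ℝ)) t).sum := by
  induction L generalizing k x with
  | nil => simpa using hx
  | cons u L ih =>
    rw [List.pairwise_cons] at hL
    cases k with
    | zero => simpa using hk
    | succ k =>
      rw [List.map_cons, List.sum_cons] at hx
      rw [List.take_succ_cons, List.map_cons, List.sum_cons]
      by_cases ht : t ∈ Ico 0 u.len
      · rw [Set.indicator_of_mem ht] at hx ⊢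
        push_cast at hk
        -- A row that reaches `t` accounts for one unit of `x` and one of the `k` rows.
        linarith [ih hL.2 (x := x - 1) (k := k) (by linarith) (by linarith)]
      · have h0 : (L.map fun u => (Ico 0 u.len).indicator (fun _ => (1 : ℝ)) t).sum = 0 := by
          refine List.sum_eq_zero fun y hy => ?_
          obtain ⟨v, hv, rfl⟩ := List.mem_map.1 hy
          exact Set.indicator_of_notMem (fun h => ht ⟨h.1, h.2.trans_le (hL.1 v hv).1⟩) _
        rw [h0, add_zero] at hx
        refine hx.trans (le_add_of_nonneg_right (List.sum_nonneg fun y hy => ?_))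
        obtain ⟨v, _, rfl⟩ := List.mem_map.1 hy
        exact Set.indicator_nonneg (fun _ _ => zero_le_one) t

theorem integral_sum_indicator (L : List (TimedWord n)) :
    Integrable (fun t => (L.map fun u => (Ico 0 u.len).indicator (fun _ => (1 : ℝ)) t).sum) ∧
    ∫ t, (L.map fun u => (Ico 0 u.len).indicator (fun _ => (1 : ℝ)) t).sum =
      (L.map len).sum := by
  induction L with
  | nil => simp
  | cons u L ih =>
    have hint : Integrable ((Ico 0 u.len).indicator fun _ => (1 : ℝ)) :=
      (integrable_indicator_iff measurableSet_Ico).2 (integrableOn_const (by simp))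
    simp only [List.map_cons, List.sum_cons]
    refine ⟨hint.add ih.1, ?_⟩
    rw [integral_add hint ih.1, ih.2, integral_indicator_const _ measurableSet_Ico]
    simp [u.len_nonneg]

/-- In a tableau, `k` disjoint chains have at most the total length of the first `k` rows. -/
theorem IsChainFamily.sum_volume_le {L : List (TimedWord n)} (hL : L.Pairwise DominatedBy)
    {k : ℕ} {σ : Fin k → WithBot (Fin n)} {S : Fin k → Set ℝ}
    (h : IsChainFamily L.reverse.prod σ S) (hS : ∀ i, MeasurableSet (S i)) :
    ∑ i, volume.real (S i) ≤ ((L.take k).map len).sum := by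
  have hvol : ∀ i, volume.real (S i) = ∫ t, columnCount L.reverse (S i) t := fun i => by
    rw [← (volume_eq_integral_columnCount L.reverse (hS i)).2,
      Set.inter_eq_right.2 (h.subset i)]
  have hint := fun i => (volume_eq_integral_columnCount L.reverse (hS i)).1
  simp_rw [hvol]
  rw [← integral_finsetSum _ fun i _ => hint i, ← (integral_sum_indicator (L.take k)).2]
  refine integral_mono (integrable_finsetSum _ fun i _ => hint i)
    (integral_sum_indicator (L.take k)).1 fun t => le_sum_take hL ?_ ?_
  · refine (Finset.sum_le_sum fun i _ => columnCount_le_one (List.pairwise_reverse.2 hL)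
      ((h.monotoneOn i).mono Set.inter_subset_right) t).trans ?_
    simp
  · refine (sum_columnCount_le L.reverse h.disjoint t).trans_eq ?_
    rw [List.map_reverse, List.sum_reverse]

end UpperBound

/-! ### Greene invariants of tableaux and of arbitrary words. -/

section Greene

theorem IsTableau.greeneAchieves_iff {w : TimedWord n} (h : w.IsTableau) (k : ℕ) (g : ℝ) :
    GreeneAchieves k w g ↔ g ≤ (w.shape.take k).sum := by
  have hw : w = w.rowDecomposition.reverse.reverse.prod := by
    rw [List.reverse_reverse, w.rowDecomposition_spec.1]
  have hrow : ∀ u ∈ w.rowDecomposition.reverse, u.IsRow := fun u hu =>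
    isRow_of_mem_rowDecomposition (List.mem_reverse.1 hu)
  have hdom := List.isChain_iff_pairwise.1 h.isChain
  rw [shape, ← List.map_take]
  constructor
  · rintro ⟨S, h1, h2, h3⟩
    rw [hw] at h1
    exact h3.trans (h1.sum_volume_le hdom fun i => (h2 i).measurableSet)
  · intro hg
    obtain ⟨S, h1, h2, h3⟩ := greeneAchieves_prod_reverse k hrow
    rw [← hw] at h1
    exact ⟨S, h1, h2, hg.trans h3⟩

/-- Equivalence in the empty context moves the problem to the tableau. The bound is attained, so the
`sSup` in `greeneInvariant` is a true supremum. -/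
theorem isGreatest_rowSubwordLengths (w : TimedWord n) (k : ℕ) :
    IsGreatest (w.rowSubwordLengths k) (w.insertionTableau.shape.take k).sum := by
  obtain ⟨htab, hequiv⟩ := insertionTableau_spec w
  have key : ∀ g, GreeneAchieves k w g ↔ g ≤ (w.insertionTableau.shape.take k).sum := fun g => by
    rw [← htab.greeneAchieves_iff]
    simpa using hequiv 1 1 k g
  have hub : ∀ s ∈ w.rowSubwordLengths k, s ≤ (w.insertionTableau.shape.take k).sum :=
    fun s hs => (key s).1 (greeneAchieves_iff.2 ⟨s, hs, le_rfl⟩)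
  obtain ⟨s, hs, hle⟩ := greeneAchieves_iff.1 ((key _).2 le_rfl)
  exact ⟨(le_antisymm hle (hub s hs)).symm ▸ hs, hub⟩

/-- In terms of `getD` with default `0`, partial sums do not see trailing zeroes. -/
theorem sum_take_eq (l : List ℝ) (k : ℕ) :
    (l.take k).sum = ∑ i ∈ Finset.range k, l.getD i 0 := by
  induction l generalizing k with
  | nil => simp
  | cons a l ih =>
    cases k with
    | zero => simp
    | succ k => rw [Finset.sum_range_succ', List.take_succ_cons, List.sum_cons, ih]; simp [add_comm]

end Greene
end TimedWord

theorem mainTheorem1 (n : ℕ) (w : TimedWord n) :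
    w.insertionTableau.IsTableau ∧
    ∀ lam : List ℝ, TimedWord.EqAsPartitions lam w.insertionTableau.shape →
      ∀ k : ℕ, 1 ≤ k → k ≤ lam.length →
        IsLUB (w.rowSubwordLengths k) (w.greeneInvariant k) ∧
        w.greeneInvariant k = (lam.take k).sum := by
  refine ⟨(TimedWord.insertionTableau_spec w).1, fun lam hlam k _ _ => ?_⟩
  have hg := TimedWord.isGreatest_rowSubwordLengths w k
  have hlub : IsLUB (w.rowSubwordLengths k) (w.greeneInvariant k) :=
    isLUB_csSup hg.nonempty hg.bddAbove
  refine ⟨hlub, (hlub.unique hg.isLUB).trans ?_⟩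
  rw [TimedWord.sum_take_eq, TimedWord.sum_take_eq]
  exact Finset.sum_congr rfl fun i _ => (hlam i).symm
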